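/- Let $L\ge 1$ and let $\Lambda$ be the hexagonal lattice with periodic boundary conditions whose sites are the $2L^2$ triangular faces of an $L\times L$ parallelogram of the triangular lattice (sides along two lattice directions, opposite sides identified), two sites being nearest neighbours if the faces share an edge. For $\sigma\in\mathcal X=\{-1,+1\}^\Lambda$ let $$H(\sigma)=-\frac J2\sum_{\{i,j\}}\sigma(i)\sigma(j)-\frac h2\sum_{i\in\Lambda}\sigma(i),$$ where the first sum runs over the unordered pairs of nearest neighbours. Assume $0<h<1$, $J\ge 2h$, $\frac{J}{2h}-\frac12\notin\mathbb Z$ and $|\Lambda|\ge(4J/h)^2$. For each inverse temperature $\beta$ let $(X_t)_{t\in\mathbb N}$ be the Metropolis Markov chain on $\mathcal X$: for $\eta\ne\sigma$, $P(\sigma,\eta)=\frac1{|\Lambda|}e^{-\beta\max(H(\eta)-H(\sigma),0)}$ if $\eta$ is obtained from $\sigma$ by flipping one spin, $P(\sigma,\eta)=0$ otherwise, and $P(\sigma,\sigma)=1-\sum_{\eta\neq\sigma}P(\sigma,\eta)$. Let $\mathbb P_\sigma$ be the law of the chain started at $\sigma$, and $\tau_A=\inf\{t>0: X_t\in A\}$.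 For $\sigma,\eta\in\mathcal X$ let $\Phi(\sigma,\eta)$ be the minimum, over all finite paths of single spin flips from $\sigma$ to $\eta$, of the maximum of $H$ along the path. Let $\mathcal I_\sigma=\{\eta: H(\eta)<H(\sigma)\}$, let $V_\sigma=\min_{\eta\in\mathcal I_\sigma}\Phi(\sigma,\eta)-H(\sigma)$ be the stability level of $\sigma$ ($V_\sigma=\infty$ if $\mathcal I_\sigma=\emptyset$), and for $V\in\mathbb R$ let $\mathcal X_V=\{\sigma: V_\sigma>V\}$. Set $V^*=2J$. Then $\mathcal X_{V^*}=\{\underline{-1},\underline{+1}\}$, the set of the two constant configurations, and for every $\epsilon>0$ the function $$f(\beta)=\sup_{\sigma\in\mathcal X}\mathbb P_\sigma\bigl(\tau_{\mathcal X_{V^*}}>e^{\beta(V^*+\epsilon)}\bigr)$$ is super-exponentially small, i.e. $\lim_{\beta\to\infty}\frac{\log f(\beta)}{\beta}=-\infty$. -/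

import Mathlib

open scoped ENNReal NNReal

namespace HexIsing

noncomputable section

/-! ### The hexagonal lattice on the torus -/

/-- The sites of the `L × L` torus: the faces of the triangular lattice with vertex set
`(ZMod L)²` (basis `e₁, e₂` at angle `π / 3`).  `inl (a, b)` is the upward triangle with vertices
`(a, b), (a+1, b), (a, b+1)`, and `inr (a, b)` is the downward triangle with vertices
`(a+1, b), (a, b+1), (a+1, b+1)`. -/
abbrev Site (L : ℕ) : Type := (ZMod L × ZMod L) ⊕ (ZMod L × ZMod L)

/-- The upward triangle `u` and the downward triangle `d` share an edge. -/
def Touches {L : ℕ} (u d : ZMod L × ZMod L) : Prop :=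
  d = u ∨ d = (u.1 - 1, u.2) ∨ d = (u.1, u.2 - 1)

instance {L : ℕ} (u d : ZMod L × ZMod L) : Decidable (Touches u d) := by
  unfold Touches; infer_instance

/-- The adjacency relation of the hexagonal lattice: two faces share an edge. -/
def SiteAdj {L : ℕ} : Site L → Site L → Prop
  | .inl u, .inr d => Touches u d
  | .inr d, .inl u => Touches u d
  | _, _ => False

instance {L : ℕ} : DecidableRel (SiteAdj (L := L)) := fun x y => by
  rcases x with x | x <;> rcases y with y | y <;> unfold SiteAdj <;> infer_instance

/-- The hexagonal lattice with periodic boundary conditions, as a graph on its sites. -/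
def hexTorus (L : ℕ) : SimpleGraph (Site L) where
  Adj := SiteAdj
  symm := ⟨fun x y => by rcases x with x | x <;> rcases y with y | y <;> exact id⟩
  loopless := ⟨fun x => by rcases x with x | x <;> exact id⟩

instance (L : ℕ) : DecidableRel (hexTorus L).Adj :=
  inferInstanceAs (DecidableRel (SiteAdj (L := L)))

/-! ### Configurations and energy -/

/-- Spin configurations; `ℤˣ = {1, -1}`. -/
abbrev Config (L : ℕ) : Type := Site L → ℤˣ

/-- The configuration with all spins equal to `+1`. -/
def allPlus (L : ℕ) : Config L := fun _ => 1

/-- The configuration with all spins equal to `-1`. -/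
def allMinus (L : ℕ) : Config L := fun _ => -1

/-- The real value `±1` of the spin at the site `i`. -/
def spin {L : ℕ} (σ : Config L) (i : Site L) : ℝ := ((σ i : ℤ) : ℝ)

/-- The product of the two spins at the ends of a bond. -/
def bondSpin {L : ℕ} (σ : Config L) : Sym2 (Site L) → ℝ :=
  Sym2.lift ⟨fun i j => spin σ i * spin σ j, fun _ _ => mul_comm _ _⟩

/-- The Hamiltonian; every nearest-neighbour bond is counted once. -/
def energy {L : ℕ} [NeZero L] (J h : ℝ) (σ : Config L) : ℝ :=
  -(J / 2) * ∑ e ∈ (hexTorus L).edgeFinset, bondSpin σ e - h / 2 * ∑ i, spin σ i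

/-- The configuration `σ` with the spin at `x` flipped. -/
def spinFlip {L : ℕ} (σ : Config L) (x : Site L) : Config L := Function.update σ x (-σ x)

theorem spinFlip_ne {L : ℕ} (σ : Config L) (x : Site L) : spinFlip σ x ≠ σ := by
  intro hx
  have h1 : spinFlip σ x x = σ x := by rw [hx]
  simp only [spinFlip, Function.update_self] at h1
  rcases Int.units_eq_one_or (σ x) with h2 | h2 <;> rw [h2] at h1 <;> revert h1 <;> decide

theorem spinFlip_spinFlip {L : ℕ} (σ : Config L) (x : Site L) : spinFlip (spinFlip σ x) x = σ := by
  simp [spinFlip]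

/-! ### Paths, communication height and stability level -/

/-- Two configurations are adjacent if they differ by a single spin flip. -/
def flipGraph (L : ℕ) : SimpleGraph (Config L) where
  Adj σ η := ∃ x, spinFlip σ x = η
  symm := ⟨by rintro σ _ ⟨x, rfl⟩; exact ⟨x, spinFlip_spinFlip σ x⟩⟩
  loopless := ⟨by rintro σ ⟨x, hx⟩; exact spinFlip_ne σ x hx⟩

/-- The maximal energy along a path of single spin flips. -/
def pathHeight {L : ℕ} [NeZero L] (J h : ℝ) {σ η : Config L} (ω : (flipGraph L).Walk σ η) :
    EReal :=
  ⨆ ζ ∈ ω.support, (energy J h ζ : EReal)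

/-- The communication height between two configurations. -/
def commHeight {L : ℕ} [NeZero L] (J h : ℝ) (σ η : Config L) : EReal :=
  ⨅ ω : (flipGraph L).Walk σ η, pathHeight J h ω

/-- The communication height between two sets of configurations (`⊤` if one of them is empty). -/
def commHeightSet {L : ℕ} [NeZero L] (J h : ℝ) (A B : Set (Config L)) : EReal :=
  ⨅ σ ∈ A, ⨅ η ∈ B, commHeight J h σ η

/-- The configurations of energy strictly lower than that of `σ`. -/
def lowerConfigs {L : ℕ} [NeZero L] (J h : ℝ) (σ : Config L) : Set (Config L) :=
  {η | energy J h η < energy J h σ}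

/-- The stability level of `σ`; it is `⊤` if no configuration has lower energy. -/
def stabLevel {L : ℕ} [NeZero L] (J h : ℝ) (σ : Config L) : EReal :=
  commHeightSet J h {σ} (lowerConfigs J h σ) - (energy J h σ : EReal)

/-- The configurations with stability level strictly greater than `V`. -/
def stableSet (L : ℕ) [NeZero L] (J h V : ℝ) : Set (Config L) :=
  {σ | (V : EReal) < stabLevel J h σ}

/-! ### The Metropolis dynamics -/

/-- The connectivity matrix (used off the diagonal only). -/
def connectivity {L : ℕ} [NeZero L] (σ η : Config L) : ℝ :=
  if ∃ x, spinFlip σ x = η then 1 / (Fintype.card (Site L) : ℝ) else 0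

/-- The Metropolis rate `q(σ, η) exp (-β [H(η) - H(σ)]₊)`. -/
def rate {L : ℕ} [NeZero L] (J h : ℝ) (β : ℝ≥0) (σ η : Config L) : ℝ :=
  connectivity σ η * Real.exp (-(β * max (energy J h η - energy J h σ) 0))

/-- The transition probabilities at inverse temperature `β`. -/
def transProb {L : ℕ} [NeZero L] (J h : ℝ) (β : ℝ≥0) (σ η : Config L) : ℝ :=
  if σ = η then 1 - ∑ ζ ∈ Finset.univ.erase σ, rate J h β σ ζ else rate J h β σ η

theorem connectivity_nonneg {L : ℕ} [NeZero L] (σ η : Config L) : 0 ≤ connectivity σ η := by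
  unfold connectivity; split_ifs <;> positivity

theorem rate_nonneg {L : ℕ} [NeZero L] (J h : ℝ) (β : ℝ≥0) (σ η : Config L) :
    0 ≤ rate J h β σ η :=
  mul_nonneg (connectivity_nonneg σ η) (Real.exp_pos _).le

theorem sum_connectivity_le {L : ℕ} [NeZero L] (σ : Config L) :
    ∑ η, connectivity σ η ≤ 1 := by
  classical
  have hc : (0 : ℝ) < (Fintype.card (Site L) : ℝ) := by exact_mod_cast Fintype.card_pos
  have h1 : (Finset.univ.filter fun η : Config L => ∃ x, spinFlip σ x = η)
      = Finset.univ.image (spinFlip σ) := by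
    ext η; simp
  have h2 : (Finset.univ.image (spinFlip σ)).card ≤ Fintype.card (Site L) := Finset.card_image_le
  have h3 : ((Finset.univ.image (spinFlip σ)).card : ℝ) ≤ Fintype.card (Site L) := by
    exact_mod_cast h2
  simp only [connectivity]
  rw [← Finset.sum_filter, h1, Finset.sum_const, nsmul_eq_mul, mul_one_div]
  exact (div_le_one hc).2 h3

theorem sum_rate_le {L : ℕ} [NeZero L] (J h : ℝ) (β : ℝ≥0) (σ : Config L) :
    ∑ ζ ∈ Finset.univ.erase σ, rate J h β σ ζ ≤ 1 := by
  refine le_trans ?_ (sum_connectivity_le σ)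
  refine le_trans (Finset.sum_le_sum_of_subset_of_nonneg (Finset.erase_subset _ _)
    fun _ _ _ => rate_nonneg J h β σ _) ?_
  refine Finset.sum_le_sum fun η _ => mul_le_of_le_one_right (connectivity_nonneg σ η) ?_
  exact Real.exp_le_one_iff.2 (neg_nonpos.2 (mul_nonneg β.2 (le_max_right _ _)))

theorem transProb_nonneg {L : ℕ} [NeZero L] (J h : ℝ) (β : ℝ≥0) (σ η : Config L) :
    0 ≤ transProb J h β σ η := by
  unfold transProb
  split_ifs
  · exact sub_nonneg.2 (sum_rate_le J h β σ)
  · exact rate_nonneg J h β σ η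

theorem sum_transProb {L : ℕ} [NeZero L] (J h : ℝ) (β : ℝ≥0) (σ : Config L) :
    ∑ η, transProb J h β σ η = 1 := by
  rw [← Finset.add_sum_erase _ _ (Finset.mem_univ σ)]
  have h1 : ∑ η ∈ Finset.univ.erase σ, transProb J h β σ η
      = ∑ η ∈ Finset.univ.erase σ, rate J h β σ η :=
    Finset.sum_congr rfl fun η hη => if_neg (Finset.ne_of_mem_erase hη).symm
  rw [h1]
  simp [transProb]

/-- The law of one step of the dynamics started at `σ`. -/
def stepPMF {L : ℕ} [NeZero L] (J h : ℝ) (β : ℝ≥0) (σ : Config L) : PMF (Config L) :=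
  PMF.ofFintype (fun η => ENNReal.ofReal (transProb J h β σ η)) (by
    rw [← ENNReal.ofReal_sum_of_nonneg fun η _ => transProb_nonneg J h β σ η, sum_transProb,
      ENNReal.ofReal_one])

instance : MeasurableSingletonClass ℤˣ where
  measurableSet_singleton u := by
    refine ⟨{(u : ℤ)}, MeasurableSet.of_discrete, ?_⟩
    ext v; simp [Units.val_inj]

/-- One step of the dynamics as a Markov kernel. -/
def stepKernel (L : ℕ) [NeZero L] (J h : ℝ) (β : ℝ≥0) :
    ProbabilityTheory.Kernel (Config L) (Config L) where
  toFun σ := (stepPMF J h β σ).toMeasure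
  measurable' := measurable_of_countable _

instance (L : ℕ) [NeZero L] (J h : ℝ) (β : ℝ≥0) :
    ProbabilityTheory.IsMarkovKernel (stepKernel L J h β) :=
  ⟨fun σ => by
    change MeasureTheory.IsProbabilityMeasure (stepPMF J h β σ).toMeasure
    infer_instance⟩

/-- The law of the step from time `n` to time `n + 1` given the trajectory up to time `n`:
it depends on the state at time `n` only. -/
def historyKernel (L : ℕ) [NeZero L] (J h : ℝ) (β : ℝ≥0) (n : ℕ) :
    ProbabilityTheory.Kernel (Finset.Iic n → Config L) (Config L) :=
  (stepKernel L J h β).comap (fun ω => ω ⟨n, Finset.mem_Iic.2 le_rfl⟩) (measurable_pi_apply _)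

instance (L : ℕ) [NeZero L] (J h : ℝ) (β : ℝ≥0) (n : ℕ) :
    ProbabilityTheory.IsMarkovKernel (historyKernel L J h β n) := by
  unfold historyKernel; infer_instance

/-- The law of the Markov chain `(X_t)` started at `σ`, on the space of trajectories. -/
def chainLaw {L : ℕ} [NeZero L] (J h : ℝ) (β : ℝ≥0) (σ : Config L) :
    MeasureTheory.Measure (ℕ → Config L) :=
  ProbabilityTheory.Kernel.trajMeasure (X := fun _ => Config L)
    (MeasureTheory.Measure.dirac σ) (historyKernel L J h β)

/-- The first hitting time `inf {t > 0 | X_t ∈ A}` along a trajectory (`⊤` if `A` is not hit). -/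
def hitTime {L : ℕ} (A : Set (Config L)) (ω : ℕ → Config L) : ℕ∞ :=
  ⨅ (t : ℕ) (_ : 0 < t ∧ ω t ∈ A), (t : ℕ∞)

/-- `P_σ (τ_A > T)`. -/
def hitTail {L : ℕ} [NeZero L] (J h : ℝ) (β : ℝ≥0) (σ : Config L) (A : Set (Config L))
    (T : ℝ) : ℝ≥0∞ :=
  chainLaw J h β σ {ω | ENNReal.ofReal T < (hitTime A ω : ℝ≥0∞)}

/-- Super-exponentially small functions of the inverse temperature: `log (f β) / β → -∞`, where
`log 0 = -∞`. -/
def IsSES (f : ℝ≥0 → ℝ≥0∞) : Prop :=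
  Filter.Tendsto (fun β : ℝ≥0 => ENNReal.log (f β) / ((β : ℝ) : EReal)) Filter.atTop (nhds ⊥)

end

end HexIsing

/-!
Let `μ` be the Gibbs weight, for which the Metropolis chain is reversible. The squared `L²(μ)`-norm
of the probability of avoiding a set `A` for `n` steps decays like `exp (-n / C)`, where `C` is the
constant of the Poincaré inequality for functions vanishing on `A`. If from every configuration one
can reach `A` by a path that climbs at most `V`, then telescoping along such paths gives
`C = O(exp (β V))`, and at time `exp (β (V + ε))` the survival probability is doubly exponentially
small.

It remains to reach a constant configuration climbing at most `2J`. Follow such paths to a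
configuration that is minimal in energy and, among those, maximal in the order on configurations;
suppose it is not constant. A straight side of length `m` of its plus region that ends with convex
corners can be peeled off: this adds `2h` per step, climbs at most `2J` as long as `(2m - 1) h < J`,
and at the last corner gains `J - h`. Minimality therefore forces `J ≤ (2m + 1) h`. Conversely, a
strip of plus spins laid along a side costs `J - h` for its first step and gains `2h` per further
step, so by `J ≤ (2m + 1) h` it has earned enough at the end of the side to turn a convex corner;
elsewhere, meeting the plus region would gain so much that minimality is violated. The strip can
thus be continued forever, which is absurd on a finite torus.
-/

namespace HexIsing

/-! ### Reversible chains -/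

section ReversibleChain

variable {X : Type*} [Fintype X] {p : X → X → ℝ} {μ : X → ℝ} {A : Set X} {C : ℝ} {f : X → ℝ}

/-- The matrix `p` is stochastic and reversible with respect to the positive weight `μ`, which
need not be normalised. -/
structure IsReversibleChain (p : X → X → ℝ) (μ : X → ℝ) : Prop where
  nonneg : ∀ x y, 0 ≤ p x y
  sum_eq_one : ∀ x, ∑ y, p x y = 1
  weight_pos : ∀ x, 0 < μ x
  detailed_balance : ∀ x y, μ x * p x y = μ y * p y x

/-- The probability that the chain with transition matrix `p` started at the given point avoids
`A` at the times `1, …, n`; the starting point itself may lie in `A`. -/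
noncomputable def survival (p : X → X → ℝ) (A : Set X) : ℕ → X → ℝ
  | 0, _ => 1
  | n + 1, x => ∑ y, p x y * Aᶜ.indicator (survival p A n) y

/-- The Dirichlet form of the chain with transition matrix `p` and weight `μ`. -/
noncomputable def dirichletForm (p : X → X → ℝ) (μ : X → ℝ) (f : X → ℝ) : ℝ :=
  (∑ x, ∑ y, μ x * p x y * (f x - f y) ^ 2) / 2

/-- The Poincaré inequality with constant `C` for the functions vanishing on `A`. -/
def PoincareOn (p : X → X → ℝ) (μ : X → ℝ) (A : Set X) (C : ℝ) : Prop :=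
  ∀ f : X → ℝ, (∀ x ∈ A, f x = 0) → ∑ x, μ x * f x ^ 2 ≤ C * dirichletForm p μ f

theorem survival_nonneg (hp : ∀ x y, 0 ≤ p x y) (n : ℕ) (x : X) : 0 ≤ survival p A n x := by
  induction n generalizing x with
  | zero => exact zero_le_one
  | succ n ih =>
    exact Finset.sum_nonneg fun y _ =>
      mul_nonneg (hp x y) (Set.indicator_nonneg (fun z _ => ih z) y)

namespace IsReversibleChain

theorem survival_succ_le (hp : IsReversibleChain p μ) (n : ℕ) (x : X) :
    survival p A (n + 1) x ≤ survival p A n x := by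
  induction n generalizing x with
  | zero =>
    refine (Finset.sum_le_sum fun y _ => ?_).trans (hp.sum_eq_one x).le
    exact mul_le_of_le_one_right (hp.nonneg x y)
      (Set.indicator_le_self' (fun _ _ => zero_le_one) y)
  | succ n ih =>
    exact Finset.sum_le_sum fun y _ =>
      mul_le_mul_of_nonneg_left (Set.indicator_le_indicator (ih y)) (hp.nonneg x y)

theorem dirichletForm_eq (hp : IsReversibleChain p μ) (f : X → ℝ) :
    dirichletForm p μ f = ∑ x, μ x * f x ^ 2 - ∑ x, μ x * f x * ∑ y, p x y * f y := by
  have sq_left : ∑ x, ∑ y, μ x * p x y * f x ^ 2 = ∑ x, μ x * f x ^ 2 := by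
    simp_rw [← Finset.sum_mul, ← Finset.mul_sum, hp.sum_eq_one, mul_one]
  have sq_right : ∑ x, ∑ y, μ x * p x y * f y ^ 2 = ∑ x, μ x * f x ^ 2 := by
    rw [Finset.sum_comm, ← sq_left]
    simp_rw [hp.detailed_balance]
  have cross : ∑ x, ∑ y, 2 * (μ x * p x y * (f x * f y)) =
      2 * ∑ x, μ x * f x * ∑ y, p x y * f y := by
    simp_rw [Finset.mul_sum]
    exact Finset.sum_congr rfl fun x _ => Finset.sum_congr rfl fun y _ => by ring
  have expand : ∀ x y, μ x * p x y * (f x - f y) ^ 2 =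
      μ x * p x y * f x ^ 2 + μ x * p x y * f y ^ 2 - 2 * (μ x * p x y * (f x * f y)) :=
    fun x y => by ring
  simp only [dirichletForm, expand, Finset.sum_sub_distrib, Finset.sum_add_distrib, sq_left,
    sq_right, cross]
  ring

theorem edge_le_dirichletForm (hp : IsReversibleChain p μ) (f : X → ℝ) (x y : X) :
    μ x * p x y * (f x - f y) ^ 2 ≤ 2 * dirichletForm p μ f := by
  have term_nonneg : ∀ a b, 0 ≤ μ a * p a b * (f a - f b) ^ 2 := fun a b =>
    mul_nonneg (mul_nonneg (hp.weight_pos a).le (hp.nonneg a b)) (sq_nonneg _)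
  calc μ x * p x y * (f x - f y) ^ 2
      ≤ ∑ b, μ x * p x b * (f x - f b) ^ 2 :=
        Finset.single_le_sum (fun b _ => term_nonneg x b) (Finset.mem_univ y)
    _ ≤ ∑ a, ∑ b, μ a * p a b * (f a - f b) ^ 2 :=
        Finset.single_le_sum (f := fun a => ∑ b, μ a * p a b * (f a - f b) ^ 2)
          (fun a _ => Finset.sum_nonneg fun b _ => term_nonneg a b) (Finset.mem_univ x)
    _ = 2 * dirichletForm p μ f := by unfold dirichletForm; ring

theorem dirichletForm_nonneg (hp : IsReversibleChain p μ) (f : X → ℝ) :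
    0 ≤ dirichletForm p μ f :=
  div_nonneg (Finset.sum_nonneg fun x _ => Finset.sum_nonneg fun y _ =>
    mul_nonneg (mul_nonneg (hp.weight_pos x).le (hp.nonneg x y)) (sq_nonneg _)) zero_le_two

theorem sum_sq_survival_le (hp : IsReversibleChain p μ) (hC : 0 < C) (hA : PoincareOn p μ A C)
    (n : ℕ) :
    ∑ x, μ x * Aᶜ.indicator (survival p A n) x ^ 2 ≤ Real.exp (-(n / C)) * ∑ x, μ x := by
  induction n with
  | zero =>
    simp only [Nat.cast_zero, zero_div, neg_zero, Real.exp_zero, one_mul]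
    refine Finset.sum_le_sum fun x _ => mul_le_of_le_one_right (hp.weight_pos x).le ?_
    exact pow_le_one₀ (Set.indicator_nonneg (fun _ _ => zero_le_one) x)
      (Set.indicator_le_self' (fun _ _ => zero_le_one) x)
  | succ n ih =>
    set f := Aᶜ.indicator (survival p A n) with hf
    -- Survival decreases in time, so one of the two factors may be taken at the earlier time.
    have step : ∑ x, μ x * Aᶜ.indicator (survival p A (n + 1)) x ^ 2 ≤
        ∑ x, μ x * f x * ∑ y, p x y * f y := by
      refine Finset.sum_le_sum fun x _ => ?_
      by_cases hx : x ∈ A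
      · simp [hf, hx]
      · rw [hf, Set.indicator_of_mem hx, Set.indicator_of_mem hx, mul_assoc, sq]
        exact mul_le_mul_of_nonneg_left (mul_le_mul_of_nonneg_right (hp.survival_succ_le n x)
          (survival_nonneg hp.nonneg (n + 1) x)) (hp.weight_pos x).le
    have contraction : ∑ x, μ x * f x * ∑ y, p x y * f y ≤
        (1 - 1 / C) * ∑ x, μ x * f x ^ 2 := by
      have gap := hA f fun x hx => by simp [hf, hx]
      rw [hp.dirichletForm_eq, ← div_le_iff₀' hC] at gap
      linarith [one_div_mul_eq_div C (∑ x, μ x * f x ^ 2)]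
    have hsum : 0 ≤ ∑ x, μ x * f x ^ 2 :=
      Finset.sum_nonneg fun x _ => mul_nonneg (hp.weight_pos x).le (sq_nonneg _)
    calc _ ≤ (1 - 1 / C) * ∑ x, μ x * f x ^ 2 := step.trans contraction
      _ ≤ Real.exp (-(1 / C)) * (Real.exp (-(n / C)) * ∑ x, μ x) := by
          gcongr
          exact Real.one_sub_le_exp_neg (1 / C)
      _ = Real.exp (-((n + 1 : ℕ) / C)) * ∑ x, μ x := by
          rw [← mul_assoc, ← Real.exp_add]
          push_cast
          ring_nf

theorem survival_succ_le_exp (hp : IsReversibleChain p μ) (hC : 0 < C)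
    (hA : PoincareOn p μ A C) {κ : ℝ} (hκ : ∀ x, ∑ y, μ y ≤ Real.exp κ * μ x) (n : ℕ) (x : X) :
    survival p A (n + 1) x ≤ Real.exp ((κ - n / C) / 2) := by
  have pointwise : ∀ y, Aᶜ.indicator (survival p A n) y ≤ Real.exp ((κ - n / C) / 2) := by
    intro y
    refine le_of_sq_le_sq ?_ (Real.exp_pos _).le
    refine le_of_mul_le_mul_left ?_ (hp.weight_pos y)
    calc μ y * Aᶜ.indicator (survival p A n) y ^ 2
        ≤ ∑ z, μ z * Aᶜ.indicator (survival p A n) z ^ 2 :=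
          Finset.single_le_sum (f := fun z => μ z * Aᶜ.indicator (survival p A n) z ^ 2)
            (fun z _ => mul_nonneg (hp.weight_pos z).le (sq_nonneg _)) (Finset.mem_univ y)
      _ ≤ Real.exp (-(n / C)) * ∑ z, μ z := hp.sum_sq_survival_le hC hA n
      _ ≤ Real.exp (-(n / C)) * (Real.exp κ * μ y) := by gcongr; exact hκ y
      _ = μ y * Real.exp ((κ - n / C) / 2) ^ 2 := by
          rw [← Real.exp_nat_mul, ← mul_assoc, ← Real.exp_add, mul_comm]
          push_cast
          ring_nf
  calc survival p A (n + 1) x ≤ ∑ y, p x y * Real.exp ((κ - n / C) / 2) :=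
        Finset.sum_le_sum fun y _ => mul_le_mul_of_nonneg_left (pointwise y) (hp.nonneg x y)
    _ = Real.exp ((κ - n / C) / 2) := by rw [← Finset.sum_mul, hp.sum_eq_one, one_mul]

theorem abs_sub_le_length_mul_sqrt (hp : IsReversibleChain p μ) {G : SimpleGraph X} {c : ℝ}
    (hc : 0 < c) {x y : X} (w : G.Walk x y) (hw : ∀ d ∈ w.darts, c ≤ μ d.fst * p d.fst d.snd) :
    |f x - f y| ≤ w.length * √(2 * dirichletForm p μ f / c) := by
  induction w with
  | nil => simp
  | @cons x z y hxz w ih =>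
    simp only [SimpleGraph.Walk.darts_cons, List.mem_cons, forall_eq_or_imp] at hw
    have first : |f x - f z| ≤ √(2 * dirichletForm p μ f / c) := by
      refine Real.abs_le_sqrt ((le_div_iff₀' hc).2 ?_)
      exact (mul_le_mul_of_nonneg_right hw.1 (sq_nonneg _)).trans (hp.edge_le_dirichletForm f x z)
    calc |f x - f y| ≤ |f x - f z| + |f z - f y| := abs_sub_le _ _ _
      _ ≤ √(2 * dirichletForm p μ f / c) + w.length * √(2 * dirichletForm p μ f / c) :=
          add_le_add first (ih hw.2)
      _ = _ := by rw [SimpleGraph.Walk.length_cons]; push_cast; ring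

theorem poincareOn_of_walks (hp : IsReversibleChain p μ) {G : SimpleGraph X} {a : X → X}
    (ha : ∀ x, a x ∈ A) (w : ∀ x, G.Walk x (a x)) {c : X → ℝ} (hc : ∀ x, 0 < c x) {M : ℝ}
    (hw : ∀ x, ∀ d ∈ (w x).darts, c x ≤ μ d.fst * p d.fst d.snd) (hM : ∀ x, μ x ≤ M * c x) :
    PoincareOn p μ A (2 * M * ∑ x, ((w x).length : ℝ) ^ 2) := by
  intro f hf
  have pointwise : ∀ x, μ x * f x ^ 2 ≤ 2 * M * (w x).length ^ 2 * dirichletForm p μ f := by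
    intro x
    have hD := hp.dirichletForm_nonneg f
    have hfx : f x ^ 2 ≤ (w x).length ^ 2 * (2 * dirichletForm p μ f / c x) := by
      have hdist := hp.abs_sub_le_length_mul_sqrt (f := f) (hc x) (w x) (hw x)
      rw [hf _ (ha x), sub_zero] at hdist
      calc f x ^ 2 = |f x| ^ 2 := (sq_abs _).symm
        _ ≤ ((w x).length * √(2 * dirichletForm p μ f / c x)) ^ 2 := by gcongr
        _ = _ := by
          rw [mul_pow, Real.sq_sqrt (div_nonneg (mul_nonneg zero_le_two hD) (hc x).le)]
    calc μ x * f x ^ 2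
        ≤ M * c x * ((w x).length ^ 2 * (2 * dirichletForm p μ f / c x)) :=
          mul_le_mul (hM x) hfx (sq_nonneg _) ((hp.weight_pos x).le.trans (hM x))
      _ = 2 * M * (w x).length ^ 2 * dirichletForm p μ f := by
          field_simp [(hc x).ne']
  calc ∑ x, μ x * f x ^ 2 ≤ ∑ x, 2 * M * (w x).length ^ 2 * dirichletForm p μ f :=
        Finset.sum_le_sum fun x _ => pointwise x
    _ = _ := by rw [← Finset.sum_mul, Finset.mul_sum]

end IsReversibleChain

theorem PoincareOn.mono (hp : IsReversibleChain p μ) {C' : ℝ}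
    (hA : PoincareOn p μ A C) (hC : C ≤ C') : PoincareOn p μ A C' := fun f hf =>
  (hA f hf).trans (mul_le_mul_of_nonneg_right hC (hp.dirichletForm_nonneg f))

end ReversibleChain

/-! ### Trajectories avoiding a set -/

section MarkovLaw

open MeasureTheory ProbabilityTheory

variable {X : Type*}

/-- The trajectories that stay outside `A` at the times `1, …, n`. -/
def avoiding (A : Set X) (n : ℕ) : Set (ℕ → X) := {ω | ∀ t, 0 < t → t ≤ n → ω t ∉ A}

theorem avoiding_succ (A : Set X) (n : ℕ) :
    avoiding A (n + 1) = avoiding A n ∩ {ω | ω (n + 1) ∉ A} := by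
  ext ω
  refine ⟨fun hω => ⟨fun t h0 ht => hω t h0 (by omega), hω _ (by omega) le_rfl⟩, ?_⟩
  rintro ⟨hω, hlast⟩ t h0 ht
  rcases Nat.lt_or_eq_of_le ht with ht | rfl
  exacts [hω t h0 (by omega), hlast]

variable [MeasurableSpace X] (κ : Kernel X X) [IsMarkovKernel κ] (x : X)

/-- The law, on the space of trajectories, of the Markov chain with transition kernel `κ` started
at `x`. -/
noncomputable def markovLaw : Measure (ℕ → X) :=
  Kernel.trajMeasure (X := fun _ => X) (Measure.dirac x) fun n =>
    κ.comap (fun ω : Finset.Iic n → X => ω ⟨n, Finset.mem_Iic.2 le_rfl⟩) (measurable_pi_apply _)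

variable {κ x}

theorem measurableSet_avoiding {A : Set X} (hA : MeasurableSet A) (n : ℕ) :
    MeasurableSet (avoiding A n) := by
  simp only [avoiding, Set.ofPred_forall]
  exact .iInter fun t => .iInter fun _ => .iInter fun _ =>
    hA.compl.preimage (measurable_pi_apply t)

theorem map_eval_zero_markovLaw : (markovLaw κ x).map (fun ω => ω 0) = Measure.dirac x := by
  have start : (markovLaw κ x).map (Preorder.frestrictLe 0) =
      (Measure.dirac x).map (MeasurableEquiv.piUnique (fun _ : Finset.Iic 0 => X)).symm := by
    rw [markovLaw, Kernel.trajMeasure, Measure.map_comp _ _ (by fun_prop),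
      Kernel.traj_map_frestrictLe, Kernel.partialTraj_self, Measure.id_comp]
  calc (markovLaw κ x).map (fun ω => ω 0)
      = ((markovLaw κ x).map (Preorder.frestrictLe 0)).map (fun u => u ⟨0, by simp⟩) := by
        rw [Measure.map_map (by fun_prop) (by fun_prop)]
        rfl
    _ = Measure.dirac x := by
        rw [start, Measure.map_map (by fun_prop) (by fun_prop)]
        exact Measure.map_id

theorem lintegral_markovLaw_mul {n : ℕ} {g : (Finset.Iic n → X) → ℝ≥0∞} (hg : Measurable g)
    {f : X → ℝ≥0∞} (hf : Measurable f) :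
    ∫⁻ ω, g (Preorder.frestrictLe n ω) * f (ω (n + 1)) ∂(markovLaw κ x) =
      ∫⁻ ω, g (Preorder.frestrictLe n ω) * ∫⁻ y, f y ∂(κ (ω n)) ∂(markovLaw κ x) := by
  have next := Kernel.map_frestrictLe_trajMeasure_compProd_eq_map_trajMeasure
    (X := fun _ => X) (μ₀ := Measure.dirac x) (a := n)
    (κ := fun n => κ.comap (fun ω : Finset.Iic n → X => ω ⟨n, Finset.mem_Iic.2 le_rfl⟩)
      (measurable_pi_apply _))
  have hgf : Measurable fun u : (Finset.Iic n → X) × X => g u.1 * f u.2 := by fun_prop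
  calc ∫⁻ ω, g (Preorder.frestrictLe n ω) * f (ω (n + 1)) ∂(markovLaw κ x)
      = ∫⁻ u, g u.1 * f u.2 ∂((markovLaw κ x).map
          (fun ω => (Preorder.frestrictLe n ω, ω (n + 1)))) := by
        rw [lintegral_map hgf (by fun_prop)]
    _ = ∫⁻ u, g u * ∫⁻ y, f y ∂(κ (u ⟨n, Finset.mem_Iic.2 le_rfl⟩))
          ∂((markovLaw κ x).map (Preorder.frestrictLe n)) := by
        rw [markovLaw, ← next, Measure.lintegral_compProd hgf]
        exact lintegral_congr fun u => lintegral_const_mul (g u) hf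
    _ = _ := by
        rw [lintegral_map _ (by fun_prop)]
        · rfl
        · exact hg.mul (hf.lintegral_kernel.comp (measurable_pi_apply _))

theorem setLIntegral_avoiding_succ {A : Set X} (hA : MeasurableSet A) (n : ℕ) {f : X → ℝ≥0∞}
    (hf : Measurable f) :
    ∫⁻ ω in avoiding A (n + 1), f (ω (n + 1)) ∂(markovLaw κ x) =
      ∫⁻ ω in avoiding A n, ∫⁻ y in Aᶜ, f y ∂(κ (ω n)) ∂(markovLaw κ x) := by
  set U : Set (Finset.Iic n → X) := {u | ∀ t : Finset.Iic n, 0 < (t : ℕ) → u t ∉ A} with hU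
  have hU_meas : MeasurableSet U := by
    simp only [hU, Set.ofPred_forall]
    exact .iInter fun t => .iInter fun _ => hA.compl.preimage (measurable_pi_apply t)
  have mem_U : ∀ ω, Preorder.frestrictLe (π := fun _ => X) n ω ∈ U ↔ ω ∈ avoiding A n := fun ω =>
    ⟨fun hω t h0 ht => hω ⟨t, Finset.mem_Iic.2 ht⟩ h0,
      fun hω t h0 => hω t h0 (Finset.mem_Iic.1 t.2)⟩
  have markov := lintegral_markovLaw_mul (κ := κ) (x := x) (n := n)
    (measurable_one.indicator hU_meas) (hf.indicator hA.compl)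
  rw [← lintegral_indicator (measurableSet_avoiding hA _),
    ← lintegral_indicator (measurableSet_avoiding hA _)]
  convert markov using 2 with ω ω
  · ext ω
    by_cases h₁ : ω ∈ avoiding A n <;> by_cases h₂ : ω (n + 1) ∈ Aᶜ <;>
      simp_all [Set.indicator, avoiding_succ]
  · ext ω
    rw [lintegral_indicator hA.compl]
    by_cases h₁ : ω ∈ avoiding A n <;> simp [Set.indicator, mem_U, h₁]

variable [Fintype X] [MeasurableSingletonClass X] {p : X → X → ℝ} {A : Set X}

theorem markovLaw_avoiding (hp : ∀ y z, 0 ≤ p y z)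
    (hκ : ∀ y z, κ y {z} = ENNReal.ofReal (p y z)) (n : ℕ) :
    markovLaw κ x (avoiding A n) = ENNReal.ofReal (survival p A n x) := by
  have hA : MeasurableSet A := A.to_countable.measurableSet
  have one_step : ∀ k y, ∫⁻ z in Aᶜ, ENNReal.ofReal (survival p A k z) ∂(κ y) =
      ENNReal.ofReal (survival p A (k + 1) y) := by
    intro k y
    have hnn := fun z => Set.indicator_nonneg (s := Aᶜ) (f := survival p A k)
      (fun w _ => survival_nonneg hp k w) z
    rw [← lintegral_indicator hA.compl, lintegral_fintype, survival,
      ENNReal.ofReal_sum_of_nonneg fun z _ => mul_nonneg (hp y z) (hnn z)]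
    refine Finset.sum_congr rfl fun z _ => ?_
    rw [hκ, ENNReal.ofReal_mul (hp y z), mul_comm]
    by_cases hz : z ∈ A <;> simp [hz]
  have avoid_then : ∀ n k, ∫⁻ ω in avoiding A n, ENNReal.ofReal (survival p A k (ω n))
      ∂(markovLaw κ x) = ENNReal.ofReal (survival p A (n + k) x) := by
    intro n
    induction n with
    | zero =>
      intro k
      have h_univ : avoiding A 0 = Set.univ := by
        ext ω; simp only [avoiding, Set.mem_ofPred_eq, Set.mem_univ, iff_true]; omega
      rw [h_univ, Measure.restrict_univ, ← lintegral_map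
        (f := fun y => ENNReal.ofReal (survival p A k y)) (measurable_of_countable _)
        (measurable_pi_apply 0), map_eval_zero_markovLaw, lintegral_dirac, zero_add]
    | succ n ih =>
      intro k
      rw [setLIntegral_avoiding_succ (f := fun y => ENNReal.ofReal (survival p A k y)) hA n
        (measurable_of_countable _)]
      simp_rw [one_step, ih, Nat.add_right_comm n 1 k, Nat.add_assoc n k 1]
  simpa [survival] using avoid_then n 0

end MarkovLaw

/-! ### Faces around a vertex -/

section Lattice

variable {L : ℕ}

/-- The six lattice directions, in counterclockwise order. -/
def latticeDir (L : ℕ) : Fin 6 → ZMod L × ZMod L :=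
  ![(1, 0), (0, 1), (-1, 1), (-1, 0), (0, -1), (1, -1)]

/-- The six faces around the vertex `v`, in counterclockwise order: `cornerSite v k` lies between
the directions `k` and `k + 1`. -/
def cornerSite (v : ZMod L × ZMod L) : Fin 6 → Site L :=
  ![.inl v, .inr (v.1 - 1, v.2), .inl (v.1 - 1, v.2), .inr (v.1 - 1, v.2 - 1),
    .inl (v.1, v.2 - 1), .inr (v.1, v.2 - 1)]

theorem cornerSite_sub_dir (v : ZMod L × ZMod L) (k : Fin 6) :
    cornerSite (v - latticeDir L k) k = cornerSite v (k + 2) := by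
  obtain ⟨a, b⟩ := v
  fin_cases k <;> simp [cornerSite, latticeDir]

theorem cornerSite_sub_dir_add_five (v : ZMod L × ZMod L) (k : Fin 6) :
    cornerSite (v - latticeDir L k) (k + 5) = cornerSite v (k + 3) := by
  obtain ⟨a, b⟩ := v
  fin_cases k <;> simp [cornerSite, latticeDir]

theorem cornerSite_sub_dir_succ (v : ZMod L × ZMod L) (k : Fin 6) :
    cornerSite (v - latticeDir L (k + 1)) (k + 2) =
      cornerSite (v - latticeDir L k) (k + 4) := by
  obtain ⟨a, b⟩ := v
  fin_cases k <;> simp [cornerSite, latticeDir]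

variable [NeZero L]

/-- The neighbours of the site `x` are the three distinct sites `a`, `b` and `c`. -/
structure HasNeighbors (x a b c : Site L) : Prop where
  neighborFinset_eq : (hexTorus L).neighborFinset x = {a, b, c}
  ne_ab : a ≠ b
  ne_ac : a ≠ c
  ne_bc : b ≠ c

theorem hasNeighbors_inl (hL : 2 ≤ L) (v : ZMod L × ZMod L) :
    HasNeighbors (.inl v : Site L) (.inr v) (.inr (v.1 - 1, v.2)) (.inr (v.1, v.2 - 1)) := by
  have : Fact (1 < L) := ⟨hL⟩
  obtain ⟨a, b⟩ := v
  constructor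
  · ext x
    rw [SimpleGraph.mem_neighborFinset]
    rcases x with x | x <;> simp [hexTorus, SiteAdj, Touches]
  all_goals simp [Prod.ext_iff, eq_comm (a := a), eq_comm (a := b)]

theorem hasNeighbors_inr (hL : 2 ≤ L) (v : ZMod L × ZMod L) :
    HasNeighbors (.inr v : Site L) (.inl v) (.inl (v.1 + 1, v.2)) (.inl (v.1, v.2 + 1)) := by
  have : Fact (1 < L) := ⟨hL⟩
  obtain ⟨a, b⟩ := v
  constructor
  · ext x
    rw [SimpleGraph.mem_neighborFinset]
    rcases x with x | x
    · simp only [hexTorus, SiteAdj, Touches, Finset.mem_insert, Finset.mem_singleton,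
        Sum.inl.injEq, Prod.ext_iff]
      grind
    · simp [hexTorus, SiteAdj]
  all_goals simp [Prod.ext_iff]

namespace HasNeighbors

variable {x a b c : Site L}

theorem rotate (H : HasNeighbors x a b c) : HasNeighbors x b c a where
  neighborFinset_eq := by
    rw [H.neighborFinset_eq]
    ext
    simp only [Finset.mem_insert, Finset.mem_singleton]
    tauto
  ne_ab := H.ne_bc
  ne_ac := H.ne_ab.symm
  ne_bc := H.ne_ac.symm

theorem swap (H : HasNeighbors x a b c) : HasNeighbors x b a c :=
  ⟨by rw [H.neighborFinset_eq, Finset.insert_comm], H.ne_ab.symm, H.ne_bc, H.ne_ac⟩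

theorem left_ne (H : HasNeighbors x a b c) : a ≠ x := by
  have hax : a ∈ (hexTorus L).neighborFinset x := by simp [H.neighborFinset_eq]
  exact ((hexTorus L).mem_neighborFinset x a).1 hax |>.ne'

theorem sum_neighbors (H : HasNeighbors x a b c) (f : Site L → ℝ) :
    ∑ y ∈ (hexTorus L).neighborFinset x, f y = f a + f b + f c := by
  rw [H.neighborFinset_eq, Finset.sum_insert (by simp [H.ne_ab, H.ne_ac]),
    Finset.sum_pair H.ne_bc, add_assoc]

end HasNeighbors

theorem hasNeighbors_cornerSite (hL : 2 ≤ L) (v : ZMod L × ZMod L) (k : Fin 6) :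
    HasNeighbors (cornerSite v (k + 2)) (cornerSite v (k + 1)) (cornerSite v (k + 3))
      (cornerSite (v - latticeDir L k) (k + 1)) := by
  obtain ⟨a, b⟩ := v
  fin_cases k
  · convert (hasNeighbors_inl hL (a - 1, b)).swap.rotate using 1 <;> simp [cornerSite, latticeDir]
  · convert (hasNeighbors_inr hL (a - 1, b - 1)).swap.rotate.rotate using 1 <;>
      simp [cornerSite, latticeDir]
  · convert (hasNeighbors_inl hL (a, b - 1)).swap using 1 <;> simp [cornerSite, latticeDir]
  · convert (hasNeighbors_inr hL (a, b - 1)).swap.rotate using 1 <;> simp [cornerSite, latticeDir]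
  · convert (hasNeighbors_inl hL (a, b)).swap.rotate.rotate using 1 <;>
      simp [cornerSite, latticeDir]
  · convert (hasNeighbors_inr hL (a - 1, b)).swap using 1 <;> simp [cornerSite, latticeDir]

end Lattice

/-! ### Energy differences -/

section Configurations

variable {L : ℕ} {σ η : Config L} {x y : Site L}

theorem spinFlip_apply_self (σ : Config L) (x : Site L) : spinFlip σ x x = -σ x :=
  Function.update_self _ _ _

theorem spinFlip_apply_of_ne (σ : Config L) (hyx : y ≠ x) : spinFlip σ x y = σ y :=
  Function.update_of_ne hyx _ _

theorem lt_spinFlip (hx : σ x = -1) : σ < spinFlip σ x :=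
  lt_update_self_iff.2 (by rw [hx]; decide)

theorem spinFlip_lt (hx : σ x = 1) : spinFlip σ x < σ :=
  update_lt_self_iff.2 (by rw [hx]; decide)

theorem eq_one_of_le (hση : σ ≤ η) (hx : σ x = 1) : η x = 1 := by
  have one_le : ∀ u : ℤˣ, 1 ≤ u → u = 1 := by decide
  exact one_le _ (hx ▸ hση x)

theorem eq_neg_one_of_le (hση : σ ≤ η) (hx : η x = -1) : σ x = -1 := by
  have le_neg_one : ∀ u : ℤˣ, u ≤ -1 → u = -1 := by decide
  exact le_neg_one _ (hx ▸ hση x)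

theorem allMinus_le (σ : Config L) : allMinus L ≤ σ := fun x => by
  have neg_one_le : ∀ u : ℤˣ, -1 ≤ u := by decide
  exact neg_one_le _

/-- The edge leaving the vertex `v` in the direction `k` has a plus face on its left and a minus
face on its right. -/
def IsBoundary (σ : Config L) (v : ZMod L × ZMod L) (k : Fin 6) : Prop :=
  σ (cornerSite v k) = 1 ∧ σ (cornerSite v (k + 5)) = -1

theorem eq_const_of_adjacent_eq [NeZero L] (h₁ : ∀ a b, σ (.inl (a, b)) = σ (.inr (a, b)))
    (h₂ : ∀ a b, σ (.inl (a + 1, b)) = σ (.inr (a, b)))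
    (h₃ : ∀ a b, σ (.inl (a, b + 1)) = σ (.inr (a, b))) : σ = allMinus L ∨ σ = allPlus L := by
  have shift_fst : ∀ a b, σ (.inl (a, b)) = σ (.inl (0, b)) := by
    intro a b
    have hper : Function.Periodic (fun a => σ (.inl (a, b))) 1 := fun a =>
      (h₂ a b).trans (h₁ a b).symm
    simpa using hper.nsmul_eq a.val
  have shift_snd : ∀ b, σ (.inl (0, b)) = σ (.inl (0, 0)) := by
    intro b
    have hper : Function.Periodic (fun b => σ (.inl (0, b))) 1 := fun b =>
      (h₃ 0 b).trans (h₁ 0 b).symm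
    simpa using hper.nsmul_eq b.val
  have hconst : ∀ x, σ x = σ (.inl (0, 0)) := by
    rintro (⟨a, b⟩ | ⟨a, b⟩)
    · rw [shift_fst, shift_snd]
    · rw [← h₁, shift_fst, shift_snd]
  rcases Int.units_eq_one_or (σ (.inl (0, 0))) with h | h
  · exact .inr (funext fun x => (hconst x).trans h)
  · exact .inl (funext fun x => (hconst x).trans h)

theorem exists_isBoundary [NeZero L] (hminus : σ ≠ allMinus L) (hplus : σ ≠ allPlus L) :
    ∃ v k, IsBoundary σ v k := by
  by_contra! hnone
  have clockwise : ∀ v k, σ (cornerSite v k) = 1 → σ (cornerSite v (k + 5)) = 1 := fun v k hk =>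
    (Int.units_eq_one_or _).resolve_right fun h => hnone v k ⟨hk, h⟩
  have eq_of : ∀ u w : ℤˣ, (u = 1 → w = 1) → (w = 1 → u = 1) → u = w := by decide
  have hconst : σ = allMinus L ∨ σ = allPlus L := by
    refine eq_const_of_adjacent_eq (fun a b => eq_of _ _ ?_ ?_) (fun a b => eq_of _ _ ?_ ?_)
      (fun a b => eq_of _ _ ?_ ?_)
    · simpa [cornerSite] using clockwise (a + 1, b) 2
    · simpa [cornerSite] using clockwise (a, b + 1) 5
    · simpa [cornerSite] using clockwise (a + 1, b + 1) 4
    · simpa [cornerSite] using clockwise (a + 1, b) 1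
    · simpa [cornerSite] using clockwise (a, b + 1) 0
    · simpa [cornerSite] using clockwise (a + 1, b + 1) 3
  exact hconst.elim hminus hplus

end Configurations

section Energy

theorem sum_incidenceFinset {V M : Type*} [Fintype V] [DecidableEq V] [AddCommMonoid M]
    (G : SimpleGraph V) [DecidableRel G.Adj] (x : V) (f : Sym2 V → M) :
    ∑ e ∈ G.incidenceFinset x, f e = ∑ y ∈ G.neighborFinset x, f s(x, y) := by
  refine (Finset.sum_nbij (fun y => s(x, y)) (fun y hy => ?_) (fun y _ z _ hyz => ?_)
    (fun e he => ?_) fun _ _ => rfl).symm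
  · simpa using hy
  · exact Sym2.congr_right.1 hyz
  · rw [SimpleGraph.coe_incidenceFinset] at he
    obtain ⟨y, rfl⟩ := Sym2.mem_iff_exists.1 he.2
    exact ⟨y, by simpa using he, rfl⟩

variable {L : ℕ} {J h : ℝ} {σ : Config L}

theorem spin_eq_one_or (σ : Config L) (x : Site L) : spin σ x = 1 ∨ spin σ x = -1 := by
  rcases Int.units_eq_one_or (σ x) with hx | hx <;> simp [spin, hx]

theorem spin_mul_spin_le_one (σ : Config L) (x y : Site L) : spin σ x * spin σ y ≤ 1 := by
  rcases spin_eq_one_or σ x with hx | hx <;> rcases spin_eq_one_or σ y with hy | hy <;>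
    norm_num [hx, hy]

theorem spin_mul_spin_of_ne {x y : Site L} (hxy : σ y ≠ σ x) : spin σ x * spin σ y = -1 := by
  rw [Int.units_ne_iff_eq_neg] at hxy
  rcases Int.units_eq_one_or (σ x) with hx | hx <;> simp [spin, hxy, hx]

theorem spin_spinFlip (σ : Config L) (x y : Site L) :
    spin (spinFlip σ x) y = spin σ y - if y = x then 2 * spin σ x else 0 := by
  split_ifs with hyx
  · rw [hyx, spin, spin, spinFlip_apply_self, Units.val_neg, Int.cast_neg]
    ring
  · simp [spin, spinFlip_apply_of_ne σ hyx]

variable [NeZero L]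

theorem sum_bondSpin_spinFlip (σ : Config L) (x : Site L) :
    ∑ e ∈ (hexTorus L).edgeFinset, bondSpin (spinFlip σ x) e =
      ∑ e ∈ (hexTorus L).edgeFinset, bondSpin σ e -
        2 * (spin σ x * ∑ y ∈ (hexTorus L).neighborFinset x, spin σ y) := by
  have unaffected : ∀ e ∈ (hexTorus L).edgeFinset, e ∉ (hexTorus L).incidenceFinset x →
      bondSpin σ e - bondSpin (spinFlip σ x) e = 0 := by
    intro e he hex
    rw [SimpleGraph.incidenceFinset_eq_filter, Finset.mem_filter, not_and] at hex
    induction e with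
    | _ y z =>
      have hne := Sym2.mem_iff.not.1 (hex he)
      push Not at hne
      simp [bondSpin, spin_spinFlip, hne.1.symm, hne.2.symm]
  have difference : ∑ e ∈ (hexTorus L).edgeFinset, (bondSpin σ e - bondSpin (spinFlip σ x) e) =
      2 * (spin σ x * ∑ y ∈ (hexTorus L).neighborFinset x, spin σ y) := by
    rw [← Finset.sum_subset ((hexTorus L).incidenceFinset_subset x) unaffected,
      sum_incidenceFinset, Finset.mul_sum, Finset.mul_sum]
    refine Finset.sum_congr rfl fun y hy => ?_
    have hyx : y ≠ x := (((hexTorus L).mem_neighborFinset x y).1 hy).ne'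
    simp only [bondSpin, Sym2.lift_mk, spin_spinFlip, if_neg hyx, if_true]
    ring
  rw [Finset.sum_sub_distrib] at difference
  linarith

theorem energy_spinFlip (J h : ℝ) (σ : Config L) (x : Site L) :
    energy J h (spinFlip σ x) = energy J h σ +
      (J * (spin σ x * ∑ y ∈ (hexTorus L).neighborFinset x, spin σ y) + h * spin σ x) := by
  have field : ∑ i, spin (spinFlip σ x) i = ∑ i, spin σ i - 2 * spin σ x := by
    simp [spin_spinFlip]
  rw [energy, energy, sum_bondSpin_spinFlip, field]
  ring

theorem energy_allPlus_lt (hJ : 0 ≤ J) (hh : 0 < h) (hσ : σ ≠ allPlus L) :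
    energy J h (allPlus L) < energy J h σ := by
  have bonds : ∑ e ∈ (hexTorus L).edgeFinset, bondSpin σ e ≤
      ∑ e ∈ (hexTorus L).edgeFinset, bondSpin (allPlus L) e := by
    refine Finset.sum_le_sum fun e _ => ?_
    induction e with
    | _ y z => simpa [bondSpin, spin, allPlus] using spin_mul_spin_le_one σ y z
  have field : ∑ i, spin σ i < ∑ i, spin (allPlus L) i := by
    obtain ⟨x, hx⟩ := Function.ne_iff.1 hσ
    have hspin : ∀ i, spin (allPlus L) i = 1 := fun i => by simp [spin, allPlus]
    refine Finset.sum_lt_sum (fun i _ => ?_) ⟨x, Finset.mem_univ x, ?_⟩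
    · rcases spin_eq_one_or σ i with hi | hi <;> norm_num [hspin, hi]
    · have hx' : σ x = -1 := Int.units_ne_iff_eq_neg.1 hx
      rw [hspin, spin, hx']
      norm_num
  unfold energy
  nlinarith

namespace HasNeighbors

variable {x a b c : Site L}

theorem energy_spinFlip_le_of_one (H : HasNeighbors x a b c) (hJ : 0 ≤ J) (ha : σ a ≠ σ x) :
    energy J h (spinFlip σ x) ≤ energy J h σ + (J + h * spin σ x) := by
  rw [energy_spinFlip, H.sum_neighbors, mul_add (spin σ x), mul_add (spin σ x),
    spin_mul_spin_of_ne ha]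
  have hb := spin_mul_spin_le_one σ x b
  have hc := spin_mul_spin_le_one σ x c
  nlinarith

theorem energy_spinFlip_le_of_two (H : HasNeighbors x a b c) (hJ : 0 ≤ J) (ha : σ a ≠ σ x)
    (hb : σ b ≠ σ x) : energy J h (spinFlip σ x) ≤ energy J h σ + (-J + h * spin σ x) := by
  rw [energy_spinFlip, H.sum_neighbors, mul_add (spin σ x), mul_add (spin σ x),
    spin_mul_spin_of_ne ha, spin_mul_spin_of_ne hb]
  have hc := spin_mul_spin_le_one σ x c
  nlinarith

theorem energy_spinFlip_of_three (H : HasNeighbors x a b c) (ha : σ a ≠ σ x) (hb : σ b ≠ σ x)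
    (hc : σ c ≠ σ x) :
    energy J h (spinFlip σ x) = energy J h σ + (-3 * J + h * spin σ x) := by
  rw [energy_spinFlip, H.sum_neighbors, mul_add (spin σ x), mul_add (spin σ x),
    spin_mul_spin_of_ne ha, spin_mul_spin_of_ne hb, spin_mul_spin_of_ne hc]
  ring

end HasNeighbors

end Energy

/-! ### Trapped configurations -/

section Trapped

variable {L : ℕ} [NeZero L] {J h B E d : ℝ} {σ η ζ : Config L} {x a b c : Site L}

/-- There is a path of single spin flips from `σ` to `η` of energy at most `B`. -/
def ConnectedBelow (J h B : ℝ) (σ η : Config L) : Prop :=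
  ∃ ω : (flipGraph L).Walk σ η, ∀ ζ ∈ ω.support, energy J h ζ ≤ B

namespace ConnectedBelow

theorem refl (hσ : energy J h σ ≤ B) : ConnectedBelow J h B σ σ :=
  ⟨.nil, by simpa using hσ⟩

theorem symm (hση : ConnectedBelow J h B σ η) : ConnectedBelow J h B η σ := by
  obtain ⟨ω, hω⟩ := hση
  exact ⟨ω.reverse, by simpa using hω⟩

theorem trans (hση : ConnectedBelow J h B σ η) (hηζ : ConnectedBelow J h B η ζ) :
    ConnectedBelow J h B σ ζ := by
  obtain ⟨ω, hω⟩ := hση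
  obtain ⟨ω', hω'⟩ := hηζ
  exact ⟨ω.append ω', fun ξ hξ =>
    ((SimpleGraph.Walk.mem_support_append_iff _ _).1 hξ).elim (hω ξ) (hω' ξ)⟩

theorem mono {B' : ℝ} (hση : ConnectedBelow J h B σ η) (hB : B ≤ B') :
    ConnectedBelow J h B' σ η :=
  hση.imp fun _ hω ζ hζ => (hω ζ hζ).trans hB

theorem energy_le (hση : ConnectedBelow J h B σ η) : energy J h η ≤ B := by
  obtain ⟨ω, hω⟩ := hση
  exact hω η ω.end_mem_support

theorem flip (hση : ConnectedBelow J h B σ η) (hx : energy J h (spinFlip η x) ≤ B) :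
    ConnectedBelow J h B σ (spinFlip η x) := by
  have hadj : (flipGraph L).Adj η (spinFlip η x) := ⟨x, rfl⟩
  exact hση.trans ⟨hadj.toWalk, by simpa using ⟨hση.energy_le, hx⟩⟩

end ConnectedBelow

/-- Paths from `σ` that climb at most `2 * J` reach no configuration of lower energy; nor, and this
is how ties between energies are broken, any larger configuration of the same energy. -/
structure Trapped (J h : ℝ) (σ : Config L) : Prop where
  energy_le : ∀ η, ConnectedBelow J h (energy J h σ + 2 * J) σ η → energy J h σ ≤ energy J h η
  energy_lt : ∀ η, ConnectedBelow J h (energy J h σ + 2 * J) σ η → σ < η →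
    energy J h σ < energy J h η

theorem exists_trapped (J h : ℝ) (σ : Config L) (hJ : 0 ≤ J) :
    ∃ η, ConnectedBelow J h (energy J h σ + 2 * J) σ η ∧ energy J h η ≤ energy J h σ ∧
      Trapped J h η := by
  have hσ : ConnectedBelow J h (energy J h σ + 2 * J) σ σ := .refl (by linarith)
  obtain ⟨η, hη, hmin⟩ := (Set.toFinite {η | ConnectedBelow J h (energy J h σ + 2 * J) σ η})
    |>.exists_minimalFor (fun η => toLex (energy J h η, OrderDual.toDual η)) _ ⟨σ, hσ⟩
  have not_better : ∀ ζ, ConnectedBelow J h (energy J h σ + 2 * J) σ ζ →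
      ¬ (energy J h ζ < energy J h η ∨ energy J h ζ = energy J h η ∧ η < ζ) := fun ζ hζ hlt =>
    (Prod.Lex.toLex_lt_toLex.2 hlt).not_ge (hmin hζ (Prod.Lex.toLex_lt_toLex.2 hlt).le)
  have hησ : energy J h η ≤ energy J h σ := not_lt.1 fun hlt => not_better σ hσ (.inl hlt)
  have reach : ∀ ζ, ConnectedBelow J h (energy J h η + 2 * J) η ζ →
      ConnectedBelow J h (energy J h σ + 2 * J) σ ζ := fun ζ hζ =>
    ConnectedBelow.trans hη (hζ.mono (by linarith))
  have hle : ∀ ζ, ConnectedBelow J h (energy J h η + 2 * J) η ζ →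
      energy J h η ≤ energy J h ζ := fun ζ hζ =>
    not_lt.1 fun hlt => not_better ζ (reach ζ hζ) (.inl hlt)
  exact ⟨η, hη, hησ, hle, fun ζ hζ hlt =>
    (hle ζ hζ).lt_of_ne fun heq => not_better ζ (reach ζ hζ) (.inr ⟨heq.symm, hlt⟩)⟩

/-- A larger configuration reached from `σ` by a path that climbs at most `2 * J`, at a net energy
cost of at most `E`. -/
structure Grown (J h : ℝ) (σ η : Config L) (E : ℝ) : Prop where
  le : σ ≤ η
  connected : ConnectedBelow J h (energy J h σ + 2 * J) σ η
  energy_le : energy J h η ≤ energy J h σ + E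

/-- A smaller configuration reached from `σ` by a path that climbs at most `2 * J`, at a net energy
cost of at most `E`. -/
structure Shrunk (J h : ℝ) (σ η : Config L) (E : ℝ) : Prop where
  le : η ≤ σ
  connected : ConnectedBelow J h (energy J h σ + 2 * J) σ η
  energy_le : energy J h η ≤ energy J h σ + E

theorem Grown.refl (σ : Config L) (hJ : 0 ≤ J) : Grown J h σ σ 0 :=
  ⟨le_rfl, .refl (by linarith), by simp⟩

theorem Shrunk.refl (σ : Config L) (hJ : 0 ≤ J) : Shrunk J h σ σ 0 :=
  ⟨le_rfl, .refl (by linarith), by simp⟩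

theorem Grown.flip (G : Grown J h σ η E) (hx : η x = -1)
    (hd : energy J h (spinFlip η x) ≤ energy J h η + d) (hE : E + d ≤ 2 * J) :
    Grown J h σ (spinFlip η x) (E + d) where
  le := G.le.trans (lt_spinFlip hx).le
  connected := G.connected.flip (by linarith [G.energy_le])
  energy_le := by linarith [G.energy_le]

theorem Shrunk.flip (S : Shrunk J h σ η E) (hx : η x = 1)
    (hd : energy J h (spinFlip η x) ≤ energy J h η + d) (hE : E + d ≤ 2 * J) :
    Shrunk J h σ (spinFlip η x) (E + d) where
  le := (spinFlip_lt hx).le.trans S.le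
  connected := S.connected.flip (by linarith [S.energy_le])
  energy_le := by linarith [S.energy_le]

namespace Trapped

theorem pos_of_grown (hσ : Trapped J h σ) (G : Grown J h σ η E) (hlt : σ < η) : 0 < E := by
  linarith [hσ.energy_lt η G.connected hlt, G.energy_le]

theorem nonneg_of_shrunk (hσ : Trapped J h σ) (S : Shrunk J h σ η E) : 0 ≤ E := by
  linarith [hσ.energy_le η S.connected, S.energy_le]

theorem grow_one (hσ : Trapped J h σ) (hJ : 0 ≤ J) (G : Grown J h σ η E) (hE : E ≤ J + h)
    (H : HasNeighbors x a b c) (hx : η x = -1) (ha : η a = 1) :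
    η b = -1 ∧ Grown J h σ (spinFlip η x) (E + (J - h)) := by
  have hs : spin η x = -1 := by simp [spin, hx]
  have hax : η a ≠ η x := by rw [ha, hx]; decide
  constructor
  · by_contra hb
    have hbx : η b ≠ η x := by rwa [hx]
    have G' := G.flip hx (H.energy_spinFlip_le_of_two hJ hax hbx) (by rw [hs]; linarith)
    have := hσ.pos_of_grown G' (G.le.trans_lt (lt_spinFlip hx))
    rw [hs] at this
    linarith
  · exact G.flip hx ((H.energy_spinFlip_le_of_one hJ hax).trans_eq (by rw [hs]; ring))
      (by linarith)

theorem grow_two (hσ : Trapped J h σ) (hJ : 0 ≤ J) (G : Grown J h σ η E) (hE : E ≤ 3 * J + h)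
    (H : HasNeighbors x a b c) (hx : η x = -1) (ha : η a = 1) (hb : η b = 1) :
    η c = -1 ∧ Grown J h σ (spinFlip η x) (E - (J + h)) := by
  have hs : spin η x = -1 := by simp [spin, hx]
  have hax : η a ≠ η x := by rw [ha, hx]; decide
  have hbx : η b ≠ η x := by rw [hb, hx]; decide
  constructor
  · by_contra hc
    have hcx : η c ≠ η x := by rwa [hx]
    have G' := G.flip hx (H.energy_spinFlip_of_three hax hbx hcx).le (by rw [hs]; linarith)
    have := hσ.pos_of_grown G' (G.le.trans_lt (lt_spinFlip hx))
    rw [hs] at this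
    linarith
  · exact G.flip hx ((H.energy_spinFlip_le_of_two hJ hax hbx).trans_eq (by rw [hs]; ring))
      (by linarith)

theorem shrink_one (hσ : Trapped J h σ) (hJ : 0 ≤ J) (S : Shrunk J h σ η E) (hE : E < J - h)
    (H : HasNeighbors x a b c) (hx : η x = 1) (ha : η a = -1) :
    η b = 1 ∧ Shrunk J h σ (spinFlip η x) (E + (J + h)) := by
  have hs : spin η x = 1 := by simp [spin, hx]
  have hax : η a ≠ η x := by rw [ha, hx]; decide
  constructor
  · by_contra hb
    have hbx : η b ≠ η x := by rwa [hx]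
    have := hσ.nonneg_of_shrunk
      (S.flip hx (H.energy_spinFlip_le_of_two hJ hax hbx) (by rw [hs]; linarith))
    rw [hs] at this
    linarith
  · exact S.flip hx ((H.energy_spinFlip_le_of_one hJ hax).trans_eq (by rw [hs]; ring))
      (by linarith)

theorem shrink_two (hσ : Trapped J h σ) (hJ : 0 ≤ J) (S : Shrunk J h σ η E)
    (hE : E < 3 * J - h) (H : HasNeighbors x a b c) (hx : η x = 1) (ha : η a = -1)
    (hb : η b = -1) : η c = 1 ∧ Shrunk J h σ (spinFlip η x) (E - (J - h)) := by
  have hs : spin η x = 1 := by simp [spin, hx]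
  have hax : η a ≠ η x := by rw [ha, hx]; decide
  have hbx : η b ≠ η x := by rw [hb, hx]; decide
  constructor
  · by_contra hc
    have hcx : η c ≠ η x := by rwa [hx]
    have := hσ.nonneg_of_shrunk
      (S.flip hx (H.energy_spinFlip_of_three hax hbx hcx).le (by rw [hs]; linarith))
    rw [hs] at this
    linarith
  · exact S.flip hx ((H.energy_spinFlip_le_of_two hJ hax hbx).trans_eq (by rw [hs]; ring))
      (by linarith)

end Trapped

end Trapped

/-! ### Strips along the boundary of the plus region -/

section Fronts

variable {L : ℕ} [NeZero L] {J h E : ℝ} {σ η : Config L} {v : ZMod L × ZMod L} {k : Fin 6} {m : ℕ}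

-- Around `v` the faces are numbered counterclockwise and the strip grows clockwise: through
-- `k + 5`, `k + 4` and `k + 3`, the last of which touches the face `k + 2` of `σ`.
theorem Grown.extend (hL : 2 ≤ L) (hJ : 0 ≤ J) (hσ : Trapped J h σ) (G : Grown J h σ η E)
    (hE : E ≤ J + h) (hplus : η (cornerSite v (k + 5)) = 1)
    (hminus : η (cornerSite v (k + 4)) = -1) :
    ∃ η', η < η' ∧ Grown J h σ η' (E + (J - h)) ∧ η' (cornerSite v (k + 4)) = 1 ∧
      η' (cornerSite v (k + 3)) = -1 := by
  have H := (hasNeighbors_cornerSite hL v (k + 2)).swap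
  simp only [add_assoc, Fin.reduceAdd] at H
  obtain ⟨hnext, G'⟩ := hσ.grow_one hJ G hE H hminus hplus
  refine ⟨_, lt_spinFlip hminus, G', ?_, ?_⟩
  · rw [spinFlip_apply_self, hminus, neg_neg]
  · rw [spinFlip_apply_of_ne _ H.swap.left_ne, hnext]

theorem Grown.advance (hL : 2 ≤ L) (hJ : 0 ≤ J) (hσ : Trapped J h σ) (G : Grown J h σ η E)
    (hE : E ≤ 3 * J + h) (hplus : η (cornerSite v (k + 4)) = 1)
    (hminus : η (cornerSite v (k + 3)) = -1) (hside : σ (cornerSite v (k + 2)) = 1) :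
    ∃ η', η < η' ∧ Grown J h σ η' (E - (J + h)) ∧
      η' (cornerSite (v - latticeDir L k) (k + 5)) = 1 ∧
      η' (cornerSite (v - latticeDir L k) (k + 4)) = -1 := by
  have H := hasNeighbors_cornerSite hL v (k + 1)
  simp only [add_assoc, Fin.reduceAdd, cornerSite_sub_dir_succ] at H
  obtain ⟨hnext, G'⟩ := hσ.grow_two hJ G hE H hminus (eq_one_of_le G.le hside) hplus
  refine ⟨_, lt_spinFlip hminus, G', ?_, ?_⟩
  · rw [cornerSite_sub_dir_add_five, spinFlip_apply_self, hminus, neg_neg]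
  · rw [spinFlip_apply_of_ne _ H.rotate.rotate.left_ne, hnext]

theorem Shrunk.advance (hL : 2 ≤ L) (hJ : 0 ≤ J) (hhJ : h < J) (hσ : Trapped J h σ)
    (S : Shrunk J h σ η E) (hE : E + h < J) (hminus : η (cornerSite v k) = -1)
    (hplus : η (cornerSite v (k + 1)) = 1) (hside : σ (cornerSite v (k + 3)) = -1) :
    ∃ η', Shrunk J h σ η' (E + 2 * h) ∧ η' (cornerSite (v - latticeDir L k) k) = -1 ∧
      η' (cornerSite (v - latticeDir L k) (k + 1)) = 1 := by
  have H₁ := hasNeighbors_cornerSite hL v (k + 5)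
  have H₂ := hasNeighbors_cornerSite hL v k
  simp only [add_assoc, Fin.reduceAdd, add_zero] at H₁
  obtain ⟨hsecond, S₁⟩ := hσ.shrink_one hJ S (by linarith) H₁ hplus hminus
  have hfirst : spinFlip η (cornerSite v (k + 1)) (cornerSite v (k + 1)) = -1 := by
    rw [spinFlip_apply_self, hplus]
  rw [← spinFlip_apply_of_ne η H₁.swap.left_ne] at hsecond
  obtain ⟨hnext, S₂⟩ := hσ.shrink_two hJ S₁ (by linarith) H₂ hsecond hfirst
    (eq_neg_one_of_le S₁.le hside)
  refine ⟨_, by convert S₂ using 1; ring, ?_, ?_⟩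
  · rw [cornerSite_sub_dir, spinFlip_apply_self, hsecond]
  · rw [spinFlip_apply_of_ne _ H₂.rotate.rotate.left_ne, hnext]

/-- The vertex `v` is reached from the start of a straight side of the plus region after `m` steps
against the direction `k`. -/
inductive SideEnd (σ : Config L) : ZMod L × ZMod L → Fin 6 → ℕ → Prop
  | start {v : ZMod L × ZMod L} {k : Fin 6} (hminus : σ (cornerSite v k) = -1)
    (hplus : σ (cornerSite v (k + 1)) = 1) : SideEnd σ v k 0
  | step {v : ZMod L × ZMod L} {k : Fin 6} {m : ℕ} (hside : SideEnd σ v k m)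
    (hplus : σ (cornerSite v (k + 2)) = 1) (hminus : σ (cornerSite v (k + 3)) = -1) :
    SideEnd σ (v - latticeDir L k) k (m + 1)

theorem SideEnd.exists_shrunk (hL : 2 ≤ L) (hh : 0 < h) (hhJ : h < J)
    (hσ : Trapped J h σ) (hside : SideEnd σ v k m) (hm : (2 * m - 1) * h < J) :
    ∃ η, Shrunk J h σ η (2 * m * h) ∧ η (cornerSite v k) = -1 ∧
      η (cornerSite v (k + 1)) = 1 := by
  have hJ : 0 ≤ J := (hh.trans hhJ).le
  induction hside with
  | start hminus hplus => exact ⟨σ, by simpa using Shrunk.refl σ hJ, hminus, hplus⟩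
  | step _ _ hminus ih =>
    push_cast at hm ⊢
    obtain ⟨η, S, hη⟩ := ih (by linarith)
    obtain ⟨η', S', hη'⟩ := S.advance hL hJ hhJ hσ (by linarith) hη.1 hη.2 hminus
    exact ⟨η', by convert S' using 1; ring, hη'⟩

theorem SideEnd.le_of_corner (hL : 2 ≤ L) (hh : 0 < h) (hhJ : h < J)
    (hσ : Trapped J h σ) (hside : SideEnd σ v k m) (hcorner : σ (cornerSite v (k + 2)) = -1) :
    J ≤ (2 * m + 1) * h := by
  have hJ : 0 ≤ J := (hh.trans hhJ).le
  by_contra! hm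
  obtain ⟨η, S, hminus, hplus⟩ := hside.exists_shrunk hL hh hhJ hσ (by linarith)
  have H := hasNeighbors_cornerSite hL v (k + 5)
  simp only [add_assoc, Fin.reduceAdd, add_zero] at H
  have hnext := (hσ.shrink_one hJ S (by linarith) H hplus hminus).1
  rw [eq_neg_one_of_le S.le hcorner] at hnext
  exact absurd hnext (by decide)

/-- The configuration `η` has grown by a strip of minus faces along the boundary of the plus region
of `σ`; the strip has followed the current straight side for `m` steps and has reached the vertex
`v`. The first step of a strip costs `J - h` and each further step along a side gains `2 * h`. The
second alternative in `side` is that of a boundary without corners, where no bound on the length of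
a side is needed. -/
structure Front (J h : ℝ) (σ : Config L) (v : ZMod L × ZMod L) (k : Fin 6) (m : ℕ)
    (η : Config L) : Prop where
  side : SideEnd σ v k m ∨ ∀ w j, IsBoundary σ w j → σ (cornerSite w (j + 2)) = 1
  boundary : IsBoundary σ v k
  plus : η (cornerSite v (k + 5)) = 1
  minus : η (cornerSite v (k + 4)) = -1
  grown : Grown J h σ η (J + h - 2 * m * h)

namespace Front

theorem exists_gt_of_straight (hL : 2 ≤ L) (hJ : 0 ≤ J) (hh : 0 < h) (hσ : Trapped J h σ)
    (F : Front J h σ v k m η) (hplus : σ (cornerSite v (k + 2)) = 1) :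
    ∃ η', η < η' ∧ Front J h σ (v - latticeDir L k) k (m + 1) η' := by
  have hm : 0 ≤ m * h := by positivity
  obtain ⟨η₁, hlt₁, G₁, hplus₁, hminus₁⟩ := F.grown.extend hL hJ hσ (by linarith) F.plus F.minus
  obtain ⟨η₂, hlt₂, G₂, hplus₂, hminus₂⟩ :=
    G₁.advance hL hJ hσ (by linarith) hplus₁ hminus₁ hplus
  have hminus : σ (cornerSite v (k + 3)) = -1 := eq_neg_one_of_le G₁.le hminus₁
  refine ⟨η₂, hlt₁.trans hlt₂, F.side.imp_left fun hside => hside.step hplus hminus, ⟨?_, ?_⟩,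
    hplus₂, hminus₂, by convert G₂ using 1; push_cast; ring⟩
  · rwa [cornerSite_sub_dir]
  · rwa [cornerSite_sub_dir_add_five]

end Front

namespace IsBoundary

theorem eq_one_succ (hL : 2 ≤ L) (hJ : 0 ≤ J) (hhJ : h < J) (hσ : Trapped J h σ)
    (hv : IsBoundary σ v k) : σ (cornerSite v (k + 1)) = 1 := by
  have H := hasNeighbors_cornerSite hL v (k + 4)
  simp only [add_assoc, Fin.reduceAdd, add_zero] at H
  exact (hσ.shrink_one hJ (.refl σ hJ) (by linarith) H hv.1 hv.2).1

theorem sideEnd_of_corner (hL : 2 ≤ L) (hJ : 0 ≤ J) (hhJ : h < J) (hσ : Trapped J h σ)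
    (hv : IsBoundary σ v k) (hcorner : σ (cornerSite v (k + 2)) = -1) :
    SideEnd σ (v - latticeDir L (k + 5)) (k + 5) 1 := by
  refine .step (.start hv.2 ?_) ?_ ?_ <;> simp only [add_assoc, Fin.reduceAdd, add_zero]
  exacts [hv.1, hv.eq_one_succ hL hJ hhJ hσ, hcorner]

theorem turn_of_corner (hL : 2 ≤ L) (hJ : 0 ≤ J) (hhJ : h < J) (hσ : Trapped J h σ)
    (hv : IsBoundary σ v k) (hcorner : σ (cornerSite v (k + 2)) = -1) :
    IsBoundary σ (v - latticeDir L (k + 5)) (k + 5) := by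
  rw [IsBoundary, cornerSite_sub_dir, cornerSite_sub_dir_add_five]
  simp only [add_assoc, Fin.reduceAdd]
  exact ⟨hv.eq_one_succ hL hJ hhJ hσ, hcorner⟩

end IsBoundary

namespace Front

theorem exists_gt_of_corner (hL : 2 ≤ L) (hh : 0 < h) (hhJ : h < J)
    (hσ : Trapped J h σ) (F : Front J h σ v k m η) (hcorner : σ (cornerSite v (k + 2)) = -1) :
    ∃ η', η < η' ∧ Front J h σ (v - latticeDir L (k + 5)) (k + 5) 1 η' := by
  have hJ : 0 ≤ J := (hh.trans hhJ).le
  have hside : SideEnd σ v k m := F.side.resolve_right fun hstraight => by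
    rw [hstraight v k F.boundary] at hcorner
    exact absurd hcorner (by decide)
  have hm := hside.le_of_corner hL hh hhJ hσ hcorner
  obtain ⟨η₁, hlt₁, G₁, hplus₁, hminus₁⟩ := F.grown.extend hL hJ hσ (by linarith) F.plus F.minus
  obtain ⟨η₂, hlt₂, G₂, hplus₂, hminus₂⟩ :=
    G₁.extend (v := v) (k := k + 5) hL hJ hσ (by linarith) (by simpa [add_assoc] using hplus₁)
      (by simpa [add_assoc] using hminus₁)
  obtain ⟨η₃, hlt₃, G₃, hplus₃, hminus₃⟩ :=
    G₂.advance hL hJ hσ (by linarith) hplus₂ hminus₂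
      (by simpa [add_assoc] using F.boundary.eq_one_succ hL hJ hhJ hσ)
  exact ⟨η₃, (hlt₁.trans hlt₂).trans hlt₃, .inl (F.boundary.sideEnd_of_corner hL hJ hhJ hσ hcorner),
    F.boundary.turn_of_corner hL hJ hhJ hσ hcorner, hplus₃, hminus₃, G₃.le, G₃.connected,
    G₃.energy_le.trans (by push_cast; linarith)⟩

theorem exists_gt (hL : 2 ≤ L) (hh : 0 < h) (hhJ : h < J) (hσ : Trapped J h σ)
    (F : Front J h σ v k m η) : ∃ η', η < η' ∧ ∃ w j n, Front J h σ w j n η' := by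
  have hJ : 0 ≤ J := (hh.trans hhJ).le
  rcases Int.units_eq_one_or (σ (cornerSite v (k + 2))) with hplus | hcorner
  · obtain ⟨η', hlt, F'⟩ := F.exists_gt_of_straight hL hJ hh hσ hplus
    exact ⟨η', hlt, _, _, _, F'⟩
  · obtain ⟨η', hlt, F'⟩ := F.exists_gt_of_corner hL hh hhJ hσ hcorner
    exact ⟨η', hlt, _, _, _, F'⟩

theorem exists_of_isBoundary (hL : 2 ≤ L) (hJ : 0 ≤ J) (hh : 0 < h) (hσ : Trapped J h σ)
    (hv : IsBoundary σ v k)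
    (hside : SideEnd σ v k 1 ∨ ∀ w j, IsBoundary σ w j → σ (cornerSite w (j + 2)) = 1) :
    ∃ η, Front J h σ v k 1 η := by
  obtain ⟨η, -, G, hplus, hminus⟩ := (Grown.refl σ hJ).extend (v := v) (k := k + 1) hL hJ hσ
    (by linarith) (by simpa [add_assoc] using hv.1) (by simpa [add_assoc] using hv.2)
  simp only [add_assoc, Fin.reduceAdd] at hplus hminus
  exact ⟨η, hside, hv, hplus, hminus, by convert G using 1; push_cast; ring⟩

end Front

theorem Trapped.eq_const (hL : 2 ≤ L) (hh : 0 < h) (hhJ : h < J) (hσ : Trapped J h σ) :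
    σ = allMinus L ∨ σ = allPlus L := by
  have hJ : 0 ≤ J := (hh.trans hhJ).le
  by_contra! hne
  obtain ⟨v, k, hv⟩ := exists_isBoundary hne.1 hne.2
  have exists_front : {η | ∃ w j n, Front J h σ w j n η}.Nonempty := by
    by_cases hstraight : ∀ w j, IsBoundary σ w j → σ (cornerSite w (j + 2)) = 1
    · obtain ⟨η, F⟩ := Front.exists_of_isBoundary hL hJ hh hσ hv (.inr hstraight)
      exact ⟨η, _, _, _, F⟩
    · push Not at hstraight
      obtain ⟨w, j, hw, hcorner⟩ := hstraight
      rw [Int.units_ne_iff_eq_neg] at hcorner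
      obtain ⟨η, F⟩ := Front.exists_of_isBoundary hL hJ hh hσ
        (hw.turn_of_corner hL hJ hhJ hσ hcorner)
        (.inl (hw.sideEnd_of_corner hL hJ hhJ hσ hcorner))
      exact ⟨η, _, _, _, F⟩
  obtain ⟨η, ⟨_, _, _, F⟩, hmax⟩ := (Set.toFinite _).exists_maximal exists_front
  obtain ⟨η', hlt, F'⟩ := F.exists_gt hL hh hhJ hσ
  exact hlt.not_ge (hmax F' hlt.le)

end Fronts

/-! ### Stability levels -/

section Stability

variable {L : ℕ} [NeZero L] {J h V : ℝ} {σ η : Config L}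

theorem stabLevel_le_of_connectedBelow (hlt : energy J h η < energy J h σ)
    (hση : ConnectedBelow J h (energy J h σ + V) σ η) : stabLevel J h σ ≤ V := by
  obtain ⟨ω, hω⟩ := hση
  have height : commHeightSet J h {σ} (lowerConfigs J h σ) ≤ ((energy J h σ + V : ℝ) : EReal) :=
    iInf₂_le_of_le σ rfl (iInf₂_le_of_le η hlt (iInf_le_of_le ω
      (iSup₂_le fun ζ hζ => EReal.coe_le_coe_iff.2 (hω ζ hζ))))
  calc stabLevel J h σ ≤ ((energy J h σ + V : ℝ) : EReal) - energy J h σ :=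
        EReal.sub_le_sub height le_rfl
    _ = V := by rw [← EReal.coe_sub, add_sub_cancel_left]

theorem le_stabLevel (hV : ∀ x, energy J h σ + V ≤ energy J h (spinFlip σ x)) :
    V ≤ stabLevel J h σ := by
  have height : ((energy J h σ + V : ℝ) : EReal) ≤
      commHeightSet J h {σ} (lowerConfigs J h σ) := by
    refine le_iInf₂ fun σ' hσ => le_iInf₂ fun η hη => le_iInf fun ω => ?_
    obtain rfl : σ' = σ := hσ
    cases ω with
    | nil => exact (lt_irrefl (energy J h σ') hη).elim
    | @cons _ ζ _ hadj ω =>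
      have hζ : energy J h σ' + V ≤ energy J h ζ := by
        obtain ⟨x, rfl⟩ := hadj
        exact hV x
      exact (EReal.coe_le_coe_iff.2 hζ).trans (le_iSup₂_of_le _ (by simp) le_rfl)
  calc (V : EReal) = ((energy J h σ + V : ℝ) : EReal) - energy J h σ := by
        rw [← EReal.coe_sub, add_sub_cancel_left]
    _ ≤ stabLevel J h σ := EReal.sub_le_sub height le_rfl

theorem stabLevel_allPlus (hJ : 0 ≤ J) (hh : 0 < h) : stabLevel J h (allPlus L) = ⊤ := by
  have no_lower : lowerConfigs J h (allPlus L) = ∅ := by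
    refine Set.eq_empty_of_forall_notMem fun η (hη : energy J h η < _) => ?_
    rcases eq_or_ne η (allPlus L) with rfl | hne
    exacts [hη.false, hη.asymm (energy_allPlus_lt hJ hh hne)]
  simp [stabLevel, commHeightSet, no_lower]

theorem energy_spinFlip_allMinus (hL : 2 ≤ L) (x : Site L) :
    energy J h (spinFlip (allMinus L) x) = energy J h (allMinus L) + (3 * J - h) := by
  obtain ⟨a, b, c, H⟩ : ∃ a b c, HasNeighbors x a b c := by
    rcases x with x | x
    exacts [⟨_, _, _, hasNeighbors_inl hL x⟩, ⟨_, _, _, hasNeighbors_inr hL x⟩]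
  have hspin : ∀ y, spin (allMinus L) y = -1 := fun y => by simp [spin, allMinus]
  rw [energy_spinFlip, H.sum_neighbors]
  simp only [hspin]
  ring

theorem exists_const_connectedBelow (hL : 2 ≤ L) (hh : 0 < h) (hhJ : h < J) (σ : Config L) :
    ∃ η ∈ ({allMinus L, allPlus L} : Set (Config L)),
      ConnectedBelow J h (energy J h σ + 2 * J) σ η := by
  obtain ⟨η, hση, -, hη⟩ := exists_trapped J h σ (hh.trans hhJ).le
  exact ⟨η, hη.eq_const hL hh hhJ, hση⟩

theorem exists_energy_lt_connectedBelow (hL : 2 ≤ L) (hh : 0 < h) (hhJ : h < J)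
    (hminus : σ ≠ allMinus L) (hplus : σ ≠ allPlus L) :
    ∃ η, energy J h η < energy J h σ ∧ ConnectedBelow J h (energy J h σ + 2 * J) σ η := by
  have hJ : 0 ≤ J := (hh.trans hhJ).le
  obtain ⟨η, hση, hle, hη⟩ := exists_trapped J h σ hJ
  refine ⟨η, ?_, hση⟩
  rcases hη.eq_const hL hh hhJ with rfl | rfl
  · refine hle.lt_of_ne fun heq => ?_
    have hlt := hη.energy_lt σ (heq ▸ hση.symm) ((allMinus_le σ).lt_of_ne hminus.symm)
    exact hlt.ne heq
  · exact energy_allPlus_lt hJ hh hplus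

theorem stableSet_eq (hL : 2 ≤ L) (hh : 0 < h) (hhJ : h < J) :
    stableSet L J h (2 * J) = {allMinus L, allPlus L} := by
  refine Set.Subset.antisymm (fun σ hσ => ?_) ?_
  · by_contra hne
    simp only [Set.mem_insert_iff, Set.mem_singleton_iff, not_or] at hne
    obtain ⟨η, hlt, hση⟩ := exists_energy_lt_connectedBelow hL hh hhJ hne.1 hne.2
    exact (stabLevel_le_of_connectedBelow hlt hση).not_gt hσ
  · rintro _ (rfl | rfl)
    · have hle := le_stabLevel fun x => (energy_spinFlip_allMinus (J := J) (h := h) hL x).ge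
      exact (EReal.coe_lt_coe_iff.2 (by linarith)).trans_le hle
    · change ((2 * J : ℝ) : EReal) < _
      rw [stabLevel_allPlus (hh.trans hhJ).le hh]
      exact EReal.coe_lt_top _

end Stability

/-! ### Survival of the Metropolis chain -/

section Metropolis

variable {L : ℕ} [NeZero L] {J h : ℝ} {β : ℝ≥0} {σ η : Config L}

/-- The unnormalised Gibbs weight at inverse temperature `β`. -/
noncomputable def gibbsWeight (J h : ℝ) (β : ℝ≥0) (σ : Config L) : ℝ :=
  Real.exp (-(β * energy J h σ))

theorem connectivity_comm (σ η : Config L) : connectivity σ η = connectivity η σ := by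
  have hcomm : (∃ x, spinFlip σ x = η) ↔ ∃ x, spinFlip η x = σ := (flipGraph L).adj_comm σ η
  simp only [connectivity, hcomm]

theorem gibbsWeight_mul_rate (σ η : Config L) :
    gibbsWeight J h β σ * rate J h β σ η =
      connectivity σ η * Real.exp (-(β * max (energy J h σ) (energy J h η))) := by
  rw [gibbsWeight, rate, mul_left_comm, ← Real.exp_add, ← mul_neg, ← mul_neg, ← mul_neg,
    ← mul_add, ← sub_self (energy J h σ), max_sub_sub_right, max_comm]
  ring_nf

theorem isReversibleChain_transProb (J h : ℝ) (β : ℝ≥0) :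
    IsReversibleChain (transProb (L := L) J h β) (gibbsWeight J h β) where
  nonneg := transProb_nonneg J h β
  sum_eq_one := sum_transProb J h β
  weight_pos _ := Real.exp_pos _
  detailed_balance σ η := by
    rcases eq_or_ne σ η with rfl | hne
    · rfl
    · rw [transProb, transProb, if_neg hne, if_neg hne.symm, gibbsWeight_mul_rate,
        gibbsWeight_mul_rate, connectivity_comm, max_comm]

theorem exp_div_card_le_gibbsWeight_mul_transProb {B : ℝ} (hadj : (flipGraph L).Adj σ η)
    (hσ : energy J h σ ≤ B) (hη : energy J h η ≤ B) :
    Real.exp (-(β * B)) / Fintype.card (Site L) ≤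
      gibbsWeight J h β σ * transProb J h β σ η := by
  have hconn : connectivity σ η = 1 / (Fintype.card (Site L) : ℝ) := if_pos hadj
  rw [transProb, if_neg hadj.ne, gibbsWeight_mul_rate, hconn, one_div_mul_eq_div]
  gcongr
  exact max_le hσ hη

theorem exists_poincareOn {A : Set (Config L)} {V : ℝ}
    (hA : ∀ σ, ∃ η ∈ A, ConnectedBelow J h (energy J h σ + V) σ η) :
    ∃ C : ℝ, 0 < C ∧ ∀ β : ℝ≥0,
      PoincareOn (transProb J h β) (gibbsWeight J h β) A (C * Real.exp (β * V)) := by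
  choose a ha w hw using hA
  set N : ℝ := (Fintype.card (Site L) : ℝ)
  have hN₀ : 0 < N := Nat.cast_pos.2 Fintype.card_pos
  set S : ℝ := ∑ σ, ((w σ).length : ℝ) ^ 2
  refine ⟨2 * N * S + 1, by positivity, fun β => ?_⟩
  have walks := (isReversibleChain_transProb J h β).poincareOn_of_walks ha w
    (c := fun σ => Real.exp (-(β * (energy J h σ + V))) / N) (M := N * Real.exp (β * V))
    (fun σ => by positivity)
    (fun σ d hd => exp_div_card_le_gibbsWeight_mul_transProb d.adj
      (hw σ _ ((w σ).dart_fst_mem_support_of_mem_darts hd))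
      (hw σ _ ((w σ).dart_snd_mem_support_of_mem_darts hd)))
    (fun σ => le_of_eq <| by
      rw [mul_add, neg_add, Real.exp_add, Real.exp_neg (β * V), gibbsWeight]
      field_simp)
  refine walks.mono (isReversibleChain_transProb J h β) ?_
  calc 2 * (N * Real.exp (β * V)) * S = 2 * N * S * Real.exp (β * V) := by ring
    _ ≤ (2 * N * S + 1) * Real.exp (β * V) := by gcongr; linarith

theorem exists_sum_gibbsWeight_le (L : ℕ) [NeZero L] (J h : ℝ) :
    ∃ D : ℝ, ∀ (β : ℝ≥0) (σ : Config L), ∑ η : Config L, gibbsWeight J h β η ≤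
      Real.exp (Real.log (Fintype.card (Config L)) + D * β) * gibbsWeight J h β σ := by
  obtain ⟨D, hD⟩ := Finite.exists_le fun x : Config L × Config L => energy J h x.1 - energy J h x.2
  refine ⟨D, fun β σ => ?_⟩
  have pointwise : ∀ η : Config L, gibbsWeight J h β η ≤
      Real.exp (D * β) * gibbsWeight J h β σ := fun η => by
    rw [gibbsWeight, gibbsWeight, ← Real.exp_add, Real.exp_le_exp]
    linarith [mul_le_mul_of_nonneg_right (hD (σ, η)) β.coe_nonneg]
  calc ∑ η : Config L, gibbsWeight J h β η
      ≤ Fintype.card (Config L) • (Real.exp (D * β) * gibbsWeight J h β σ) :=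
        Finset.sum_le_card_nsmul _ _ _ fun η _ => pointwise η
    _ = _ := by
        rw [Real.exp_add, Real.exp_log (by exact_mod_cast Fintype.card_pos), nsmul_eq_mul,
          mul_assoc]

theorem hitTail_le_survival (β : ℝ≥0) (σ : Config L) (A : Set (Config L)) {T : ℝ} {n : ℕ}
    (hn : n ≤ T) :
    hitTail J h β σ A T ≤ ENNReal.ofReal (survival (transProb J h β) A n σ) := by
  have kernel_singleton : ∀ η ζ, stepKernel L J h β η {ζ} =
      ENNReal.ofReal (transProb J h β η ζ) := fun η ζ =>
    PMF.toMeasure_apply_singleton _ _ (MeasurableSet.singleton ζ)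
  rw [← markovLaw_avoiding (transProb_nonneg J h β) kernel_singleton]
  refine MeasureTheory.measure_mono fun ω hω t h0 ht hA => ?_
  have hit_le : ((hitTime A ω : ℕ∞) : ℝ≥0∞) ≤ (t : ℝ≥0∞) := by
    exact_mod_cast (iInf₂_le t ⟨h0, hA⟩ : hitTime A ω ≤ t)
  have le_T : (t : ℝ≥0∞) ≤ ENNReal.ofReal T := by
    rw [← ENNReal.ofReal_natCast]
    exact ENNReal.ofReal_le_ofReal (le_trans (by exact_mod_cast ht) hn)
  exact (hit_le.trans le_T).not_gt hω

end Metropolis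

section SuperExponential

theorem IsSES.of_le_exp {f : ℝ≥0 → ℝ≥0∞} {g : ℝ → ℝ}
    (hf : ∀ β : ℝ≥0, f β ≤ ENNReal.ofReal (Real.exp (g β)))
    (hg : Filter.Tendsto (fun β => g β / β) Filter.atTop Filter.atBot) : IsSES f := by
  have upper : Filter.Tendsto (fun β : ℝ≥0 => ((g β / β : ℝ) : EReal)) Filter.atTop (nhds ⊥) :=
    EReal.tendsto_coe_nhds_bot_iff.2 (hg.comp (NNReal.tendsto_coe_atTop.2 Filter.tendsto_id))
  refine tendsto_of_tendsto_of_tendsto_of_le_of_le tendsto_const_nhds upper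
    (fun _ => bot_le) fun β => ?_
  have hlog := ENNReal.log_monotone (hf β)
  rw [ENNReal.log_ofReal_of_pos (Real.exp_pos _), Real.log_exp] at hlog
  exact EReal.div_le_div_right_of_nonneg (EReal.coe_nonneg.2 β.2) hlog

theorem tendsto_affine_sub_exp_div_atBot (a D : ℝ) {b ε : ℝ} (hb : 0 < b) (hε : 0 < ε) :
    Filter.Tendsto (fun x => (a + D * x - b * Real.exp (x * ε)) / x) Filter.atTop Filter.atBot := by
  have growth : Filter.Tendsto (fun x => ε * ((b * Real.exp (x * ε) + -a) / (x * ε) ^ 1))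
      Filter.atTop Filter.atTop :=
    ((Real.tendsto_mul_exp_add_div_pow_atTop b (-a) 1 hb).comp
      (Filter.tendsto_id.atTop_mul_const hε)).const_mul_atTop hε
  refine (Filter.tendsto_atBot_add_const_left _ D
    (Filter.tendsto_neg_atTop_atBot.comp growth)).congr' ?_
  filter_upwards [Filter.eventually_gt_atTop 0] with x hx
  simp only [Function.comp_apply]
  field_simp
  ring

theorem isSES_hitTail {L : ℕ} [NeZero L] {J h V ε : ℝ} {A : Set (Config L)} (hε : 0 < ε)
    (hA : ∀ σ, ∃ η ∈ A, ConnectedBelow J h (energy J h σ + V) σ η) :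
    IsSES fun β : ℝ≥0 => ⨆ σ, hitTail J h β σ A (Real.exp (β * (V + ε))) := by
  obtain ⟨C, hC, poincare⟩ := exists_poincareOn hA
  obtain ⟨D, hD⟩ := exists_sum_gibbsWeight_le L J h
  have hV : 0 ≤ V := by
    obtain ⟨η, -, hη⟩ := hA (allPlus L)
    linarith [hη.symm.energy_le]
  set κ := Real.log (Fintype.card (Config L))
  refine .of_le_exp (g := fun β => ((κ + 2 / C) / 2) + D / 2 * β - 1 / (2 * C) * Real.exp (β * ε))
    (fun β => iSup_le fun σ => ?_) (tendsto_affine_sub_exp_div_atBot _ _ (by positivity) hε)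
  set T := Real.exp (β * (V + ε)) with hT
  have hT₁ : 1 ≤ T := Real.one_le_exp (by positivity)
  set n := ⌊T - 1⌋₊
  have hn : (n + 1 : ℕ) ≤ T := by
    push_cast
    linarith [Nat.floor_le (sub_nonneg.2 hT₁)]
  refine (hitTail_le_survival β σ A hn).trans (ENNReal.ofReal_le_ofReal ?_)
  refine ((isReversibleChain_transProb J h β).survival_succ_le_exp (by positivity) (poincare β)
    (hD β) n σ).trans (Real.exp_le_exp.2 ?_)
  have decay : (Real.exp (β * ε) - 2) / C ≤ n / (C * Real.exp (β * V)) := by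
    have hexp : 1 ≤ Real.exp (β * V) := Real.one_le_exp (by positivity)
    have hT_eq : T = Real.exp (β * ε) * Real.exp (β * V) := by
      rw [hT, ← Real.exp_add]
      ring_nf
    rw [div_le_div_iff₀ hC (by positivity)]
    nlinarith [Nat.lt_floor_add_one (T - 1)]
  have split : (Real.exp (β * ε) - 2) / C = 2 * (1 / (2 * C) * Real.exp (β * ε)) - 2 / C := by
    field_simp
  linarith

end SuperExponential

theorem two_le_of_card_site {L : ℕ} [NeZero L] {J h : ℝ} (hh : 0 < h) (hJ : 2 * h ≤ J)
    (hcard : (4 * J / h) ^ 2 ≤ Fintype.card (Site L)) : 2 ≤ L := by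
  have ratio : 8 ≤ 4 * J / h := by
    rw [le_div_iff₀ hh]
    linarith
  have hL := NeZero.ne L
  by_contra hlt
  obtain rfl : L = 1 := by omega
  have card_site : (Fintype.card (Site 1) : ℝ) = 2 := by simp [Site]
  nlinarith

end HexIsing

theorem proposition1_general {L : ℕ} [NeZero L] {J h : ℝ} (hL : 2 ≤ L) (h_pos : 0 < h)
    (h_lt : h < J) :
    HexIsing.stableSet L J h (2 * J) = {HexIsing.allMinus L, HexIsing.allPlus L} ∧
      ∀ ε : ℝ, 0 < ε →
        HexIsing.IsSES fun β : ℝ≥0 => ⨆ σ : HexIsing.Config L,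
          HexIsing.hitTail J h β σ (HexIsing.stableSet L J h (2 * J))
            (Real.exp (β * (2 * J + ε))) := by
  have hstable := HexIsing.stableSet_eq hL h_pos h_lt
  refine ⟨hstable, fun ε hε => ?_⟩
  rw [hstable]
  exact HexIsing.isSES_hitTail hε (HexIsing.exists_const_connectedBelow hL h_pos h_lt)

theorem proposition1 (L : ℕ) [NeZero L] (J h : ℝ) (h_pos : 0 < h) (h_lt_one : h < 1)
    (hJ : 2 * h ≤ J) (h_nonint : ∀ n : ℤ, J / (2 * h) - 1 / 2 ≠ (n : ℝ))
    (h_torus : (4 * J / h) ^ 2 ≤ (Fintype.card (HexIsing.Site L) : ℝ)) :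
    HexIsing.stableSet L J h (2 * J) = {HexIsing.allMinus L, HexIsing.allPlus L} ∧
      ∀ ε : ℝ, 0 < ε →
        HexIsing.IsSES fun β : ℝ≥0 => ⨆ σ : HexIsing.Config L,
          HexIsing.hitTail J h β σ (HexIsing.stableSet L J h (2 * J))
            (Real.exp (β * (2 * J + ε))) :=
  proposition1_general (HexIsing.two_le_of_card_site h_pos hJ h_torus) h_pos (by linarith)
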